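/- Fix a horizon $N\in\mathbb N$ and matrices $A_k\in\mathbb R^{n\times n}$, $B_k\in\mathbb R^{n\times m}$, $W_k\succ 0$, $M_0\succeq 0$, a vector $m_0\in\mathbb R^n$, weights $Q_k\succeq 0$ ($k\le N+1$), $R_k\succ 0$ ($k\le N$), and real numbers $\theta_k$. Consider $$x_{k+1}=A_kx_k+B_ku_k+w_k,\qquad k\ge 0,$$ where $x_0\sim\mathcal N(m_0,M_0)$ and $w_k\sim\mathcal N(0,W_k)$ are independent. At time $k$ an event trigger chooses $\delta_k\in\{0,1\}$; the controller receives, with a delay of one step, $z_k=x_k$ if $\delta_k=1$ and the empty symbol $z_k=\varnothing$ if $\delta_k=0$. A (possibly randomized) triggering policy $\pi$ chooses $\delta_k$ as a measurable function of $x_0,\dots,x_k$, of the past events and controls, and of a private random seed; a (possibly randomized) control policy $\mu$ chooses $u_k$ as a measurable function of $z_0,\dots,z_{k-1}$, of the past controls, and of a private random seed. The two seeds, $x_0$ and $(w_k)$ are independent. The common cost is $$\Psi(\pi,\mu)=\mathbb E\Big[x_{N+1}^TQ_{N+1}x_{N+1}+\sum_{k=0}^N\big(x_k^TQ_kx_k+u_k^TR_ku_k+\theta_k\delta_k\big)\Big]\in(-\infty,\infty].$$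 Let $S_{N+1}=Q_{N+1}$, $\Gamma_{N+1}=0$ and, for $k=N,\dots,0$, $$S_k=Q_k+A_k^TS_{k+1}A_k-\Gamma_k,\quad \Gamma_k=A_k^TS_{k+1}B_k(B_k^TS_{k+1}B_k+R_k)^{-1}B_k^TS_{k+1}A_k,\quad L_k=(B_k^TS_{k+1}B_k+R_k)^{-1}B_k^TS_{k+1}A_k.$$ Non-transmitted observations are discarded in the estimate at the controller, that is, $\hat x_0=m_0$ and $$\hat x_{k+1}=A_k\hat x_k+B_ku_k+\delta_kA_k(x_k-\hat x_k),$$ and $e_k=x_k-\hat x_k$ is the estimation error. Let $V_{N+1}=0$ and, for $k=N,\dots,0$, $$V_k(e)=\min_{\delta\in\{0,1\}}\mathbb E\big[\theta_k\delta+e_+^T\Gamma_{k+1}e_++V_{k+1}(e_+)\big],\quad e_+=(1-\delta)A_ke+w_k,$$ and put $$\varrho_k=\varrho_k(e_k),\quad \varrho_k(e)=\mathbb E[V_{k+1}(A_ke+w_k)]-\mathbb E[V_{k+1}(w_k)],\qquad \mathrm{VoI}_k=e_k^TA_k^T\Gamma_{k+1}A_ke_k-\theta_k+\varrho_k .$$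 Then the policies $\pi^*:\ \delta_k^*=\mathbf 1_{\mathrm{VoI}_k\ge 0}$ and $\mu^*:\ u_k^*=-L_k\hat x_k$ are admissible and form a Nash equilibrium: $\Psi(\pi^*,\mu^*)\le\Psi(\pi,\mu^*)$ for every triggering policy $\pi$ and $\Psi(\pi^*,\mu^*)\le\Psi(\pi^*,\mu)$ for every control policy $\mu$; moreover $\Psi(\pi^*,\mu^*)<\infty$. The triggering policy is symmetric: for every $k\le N$, $\varrho_k$, and hence $\mathrm{VoI}_k$, is an even function of $e_k$. The policy $\mu^*$ is not randomized and, against every non-randomized control policy, the events produced by $\pi^*$ at times $k\le N$ are measurable functions of $x_0,\dots,x_k$ alone. Under $(\pi^*,\mu^*)$ the estimate is the conditional mean at the controller: $\hat x_k=\mathbb E[x_k\mid z_0,\dots,z_{k-1}]$ almost surely for every $k\le N$. -/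

import Mathlib

open MeasureTheory ProbabilityTheory
open scoped Matrix

noncomputable section

namespace EventTrig

/-- States and controls are column vectors. -/
abbrev Vec (n : ℕ) : Type := Fin n → ℝ

/-- The quadratic form `xᵀ M x`. -/
def quad {n : ℕ} (M : Matrix (Fin n) (Fin n) ℝ) (x : Vec n) : ℝ := x ⬝ᵥ (M *ᵥ x)

/-- The data of the problem: horizon `N`, dynamics, noise covariances, law of the initial state,
weighting matrices and communication prices. -/
structure Data (n m : ℕ) where
  N : ℕ
  A : ℕ → Matrix (Fin n) (Fin n) ℝ
  B : ℕ → Matrix (Fin n) (Fin m) ℝ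
  W : ℕ → Matrix (Fin n) (Fin n) ℝ
  m₀ : Vec n
  M₀ : Matrix (Fin n) (Fin n) ℝ
  Q : ℕ → Matrix (Fin n) (Fin n) ℝ
  R : ℕ → Matrix (Fin m) (Fin m) ℝ
  θ : ℕ → ℝ

/-- The definiteness assumptions on the weights and covariances. -/
structure Data.WellPosed {n m : ℕ} (D : Data n m) : Prop where
  posDef_W : ∀ k, (D.W k).PosDef
  posSemidef_M₀ : D.M₀.PosSemidef
  posSemidef_Q : ∀ k, k ≤ D.N + 1 → (D.Q k).PosSemidef
  posDef_R : ∀ k, k ≤ D.N → (D.R k).PosDef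

variable {n m : ℕ}

/-! ### Riccati equation and LQR gain -/

/-- `S_{N+1-j}`, computed by the backward Riccati recursion. -/
def Data.riccatiBack (D : Data n m) : ℕ → Matrix (Fin n) (Fin n) ℝ
  | 0 => D.Q (D.N + 1)
  | j + 1 =>
      let k := D.N - j
      let T := D.riccatiBack j
      D.Q k + (D.A k)ᵀ * T * D.A k
        - (D.A k)ᵀ * T * D.B k * ((D.B k)ᵀ * T * D.B k + D.R k)⁻¹ * (D.B k)ᵀ * T * D.A k

/-- The Riccati matrix `S_k`, for `k ≤ N + 1`. -/
def Data.S (D : Data n m) (k : ℕ) : Matrix (Fin n) (Fin n) ℝ := D.riccatiBack (D.N + 1 - k)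

/-- `Γ_k = A_kᵀ S_{k+1} B_k (B_kᵀ S_{k+1} B_k + R_k)⁻¹ B_kᵀ S_{k+1} A_k` for `k ≤ N`, and
`Γ_{N+1} = 0`. -/
def Data.Γ (D : Data n m) (k : ℕ) : Matrix (Fin n) (Fin n) ℝ :=
  if k ≤ D.N then
    (D.A k)ᵀ * D.S (k + 1) * D.B k * ((D.B k)ᵀ * D.S (k + 1) * D.B k + D.R k)⁻¹
      * (D.B k)ᵀ * D.S (k + 1) * D.A k
  else 0

/-- The LQR gain `L_k = (B_kᵀ S_{k+1} B_k + R_k)⁻¹ B_kᵀ S_{k+1} A_k`. -/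
def Data.L (D : Data n m) (k : ℕ) : Matrix (Fin m) (Fin n) ℝ :=
  ((D.B k)ᵀ * D.S (k + 1) * D.B k + D.R k)⁻¹ * (D.B k)ᵀ * D.S (k + 1) * D.A k

/-! ### Information, policies and estimator -/

/-- Output `z_k` of the event trigger: `inl x` if the state `x` is transmitted, and the empty
symbol `inr ()` otherwise. -/
abbrev Signal (n : ℕ) : Type := Vec n ⊕ Unit

/-- The output of the event trigger for state `x` and event `δ`. -/
def emit (x : Vec n) (δ : Bool) : Signal n := if δ then Sum.inl x else Sum.inr ()

/-- The signals `z_0, …, z_{k-1}` obtained from `x_0, …, x_k` and `δ_0, …, δ_{k-1}`. -/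
def signals {k : ℕ} (x : Fin (k + 1) → Vec n) (δ : Fin k → Bool) : Fin k → Signal n :=
  fun t => emit (x t.castSucc) (δ t)

/-- A (randomized) triggering policy. At time `k` the event is a function of the trigger's
private random seed, of the states `x_0, …, x_k`, and of the events and controls before
time `k`. -/
abbrev TriggerPolicy (n m : ℕ) (Se : Type*) : Type _ :=
  (k : ℕ) → Se → (Fin (k + 1) → Vec n) → (Fin k → Bool) → (Fin k → Vec m) → Bool

/-- A (randomized) control policy. At time `k` the control is a function of the controller's
private random seed, of the received signals `z_0, …, z_{k-1}` (one-step delay), and of its own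
controls before time `k`. -/
abbrev ControlPolicy (n m : ℕ) (Sc : Type*) : Type _ :=
  (k : ℕ) → Sc → (Fin k → Signal n) → (Fin k → Vec m) → Vec m

/-- Admissible triggering policies: measurable functions of the available information. -/
def admissibleTrigger (n m : ℕ) (Se : Type*) [MeasurableSpace Se] :
    Set (TriggerPolicy n m Se) :=
  {π | ∀ k, Measurable fun h : Se × (Fin (k + 1) → Vec n) × (Fin k → Bool) × (Fin k → Vec m) =>
    π k h.1 h.2.1 h.2.2.1 h.2.2.2}

/-- Admissible control policies: measurable functions of the available information. -/
def admissibleControl (n m : ℕ) (Sc : Type*) [MeasurableSpace Sc] :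
    Set (ControlPolicy n m Sc) :=
  {μ | ∀ k, Measurable fun h : Sc × (Fin k → Signal n) × (Fin k → Vec m) =>
    μ k h.1 h.2.1 h.2.2}

/-- A control policy is non-randomized if it ignores the private seed. -/
def NonRandomized {Sc : Type*} (μ : ControlPolicy n m Sc) : Prop :=
  ∀ k c c' z u, μ k c z u = μ k c' z u

/-- The estimate `x̂_k` as a function of the received signals and the applied controls:
`x̂_0 = m_0`, `x̂_{k+1} = A_k x̂_k + B_k u_k + δ_k A_k (x_k - x̂_k)`; nothing is inferred from an
empty signal. -/
def Data.estimate (D : Data n m) : (k : ℕ) → (Fin k → Signal n) → (Fin k → Vec m) → Vec n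
  | 0, _, _ => D.m₀
  | k + 1, z, u =>
      let xh := D.estimate k (Fin.init z) (Fin.init u)
      D.A k *ᵥ xh + D.B k *ᵥ u (Fin.last k)
        + Sum.elim (fun x => D.A k *ᵥ (x - xh)) (fun _ => 0) (z (Fin.last k))

/-! ### Closed loop -/

/-- The closed-loop history `(x_0, …, x_k), (δ_0, …, δ_{k-1}), (u_0, …, u_{k-1})` for the seeds
`s`, `c`, the initial state `x₀` and the noise realization `w`. -/
def Data.history (D : Data n m) {Se Sc : Type*} (π : TriggerPolicy n m Se)
    (μ : ControlPolicy n m Sc) (s : Se) (c : Sc) (x₀ : Vec n) (w : ℕ → Vec n) :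
    (k : ℕ) → (Fin (k + 1) → Vec n) × (Fin k → Bool) × (Fin k → Vec m)
  | 0 => (fun _ => x₀, Fin.elim0, Fin.elim0)
  | k + 1 =>
      let h := D.history π μ s c x₀ w k
      let δ := π k s h.1 h.2.1 h.2.2
      let u := μ k c (signals h.1 h.2.1) h.2.2
      (Fin.snoc (α := fun _ => Vec n) h.1 (D.A k *ᵥ h.1 (Fin.last k) + D.B k *ᵥ u + w k),
        Fin.snoc (α := fun _ => Bool) h.2.1 δ, Fin.snoc (α := fun _ => Vec m) h.2.2 u)

variable {Ω Se Sc : Type*}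

/-- The primitive random variables: initial state, process noise, and the private seeds of the
event trigger and of the controller. -/
structure Primitives (n : ℕ) (Ω Se Sc : Type*) where
  x₀ : Ω → Vec n
  w : ℕ → Ω → Vec n
  ξ : Ω → Se
  η : Ω → Sc

/-- `X` is a Gaussian vector with mean `a` and covariance matrix `M`. -/
def IsGaussianVec [MeasurableSpace Ω] (P : Measure Ω) (X : Ω → Vec n) (a : Vec n)
    (M : Matrix (Fin n) (Fin n) ℝ) : Prop :=
  HasGaussianLaw X P ∧ (∀ i, ∫ ω, X ω i ∂P = a i) ∧
    ∀ i j, cov[fun ω => X ω i, fun ω => X ω j; P] = M i j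

/-- The laws of the primitive random variables: Gaussian initial state, independent zero-mean
Gaussian noise, and seeds of arbitrary law, all independent. -/
structure Primitives.HasLaws [MeasurableSpace Ω] [MeasurableSpace Se] [MeasurableSpace Sc]
    (p : Primitives n Ω Se Sc) (D : Data n m) (P : Measure Ω) : Prop where
  measurable_x₀ : Measurable p.x₀
  measurable_w : ∀ k, Measurable (p.w k)
  measurable_ξ : Measurable p.ξ
  measurable_η : Measurable p.η
  gaussian_x₀ : IsGaussianVec P p.x₀ D.m₀ D.M₀
  gaussian_w : ∀ k, IsGaussianVec P (p.w k) 0 (D.W k)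
  indep_w : iIndepFun p.w P
  indep_x₀ : IndepFun p.x₀ (fun ω k => p.w k ω) P
  indep_ξ : IndepFun p.ξ (fun ω => (p.x₀ ω, fun k => p.w k ω)) P
  indep_η : IndepFun p.η (fun ω => (p.ξ ω, p.x₀ ω, fun k => p.w k ω)) P

section ClosedLoop

variable (D : Data n m) (p : Primitives n Ω Se Sc) (π : TriggerPolicy n m Se)
  (μ : ControlPolicy n m Sc)

/-- The random closed-loop history. -/
def hist (k : ℕ) (ω : Ω) : (Fin (k + 1) → Vec n) × (Fin k → Bool) × (Fin k → Vec m) :=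
  D.history π μ (p.ξ ω) (p.η ω) (p.x₀ ω) (fun t => p.w t ω) k

/-- The state `x_k`. -/
def state (k : ℕ) (ω : Ω) : Vec n := (hist D p π μ k ω).1 (Fin.last k)

/-- The states `x_0, …, x_k`. -/
def states (k : ℕ) (ω : Ω) : Fin (k + 1) → Vec n := (hist D p π μ k ω).1

/-- The received signals `z_0, …, z_{k-1}`. -/
def received (k : ℕ) (ω : Ω) : Fin k → Signal n :=
  signals (hist D p π μ k ω).1 (hist D p π μ k ω).2.1

/-- The event `δ_k`. -/
def event (k : ℕ) (ω : Ω) : Bool :=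
  π k (p.ξ ω) (hist D p π μ k ω).1 (hist D p π μ k ω).2.1 (hist D p π μ k ω).2.2

/-- The control `u_k`. -/
def control (k : ℕ) (ω : Ω) : Vec m :=
  μ k (p.η ω) (received D p π μ k ω) (hist D p π μ k ω).2.2

/-- The estimate `x̂_k` at the controller. -/
def xhat (k : ℕ) (ω : Ω) : Vec n :=
  D.estimate k (received D p π μ k ω) (hist D p π μ k ω).2.2

/-- The cost
`Ψ(π, μ) = E[x_{N+1}ᵀ Q_{N+1} x_{N+1} + ∑_{k=0}^N (x_kᵀ Q_k x_k + u_kᵀ R_k u_k + θ_k δ_k)]`.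
The nonnegative quadratic part may have infinite expectation, the bounded communication part is
always integrable; the cost lies in `(-∞, ∞]`. -/
def cost [MeasurableSpace Ω] (P : Measure Ω) : EReal :=
  ((∫⁻ ω, ENNReal.ofReal
      (quad (D.Q (D.N + 1)) (state D p π μ (D.N + 1) ω)
        + ∑ k ∈ Finset.range (D.N + 1),
          (quad (D.Q k) (state D p π μ k ω) + quad (D.R k) (control D p π μ k ω))) ∂P :
      ENNReal) : EReal)
  + ((∫ ω, ∑ k ∈ Finset.range (D.N + 1),
      D.θ k * (if event D p π μ k ω then 1 else 0) ∂P : ℝ) : EReal)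

end ClosedLoop

/-! ### Value of information -/

section VoI

variable [MeasurableSpace Ω] (D : Data n m) (P : Measure Ω) (w : ℕ → Ω → Vec n)

/-- `V_{N+1-j}` by backward dynamic programming for the estimation error, whose dynamics are
`e_{k+1} = (1 - δ_k) A_k e_k + w_k`:
`V_{N+1} = 0`, `V_k(e) = min_δ E[θ_k δ + e_{k+1}ᵀ Γ_{k+1} e_{k+1} + V_{k+1}(e_{k+1}) | e_k = e]`,
with `δ` ranging over `{0, 1}`. -/
def valueBack : ℕ → Vec n → ℝ
  | 0, _ => 0
  | j + 1, e =>
      let k := D.N - j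
      min
        (∫ ω, (quad (D.Γ (k + 1)) (D.A k *ᵥ e + w k ω)
          + valueBack j (D.A k *ᵥ e + w k ω)) ∂P)
        (D.θ k + ∫ ω, (quad (D.Γ (k + 1)) (w k ω) + valueBack j (w k ω)) ∂P)

/-- The value function `V_k` of the event trigger, for `k ≤ N + 1`. -/
def value (k : ℕ) (e : Vec n) : ℝ := valueBack D P w (D.N + 1 - k) e

/-- `ϱ_k = E[V_{k+1}(e_{k+1}) | e_k, δ_k = 0] - E[V_{k+1}(e_{k+1}) | e_k, δ_k = 1]`, as a function
of the estimation error `e_k = e`. -/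
def rho (k : ℕ) (e : Vec n) : ℝ :=
  (∫ ω, value D P w (k + 1) (D.A k *ᵥ e + w k ω) ∂P) - ∫ ω, value D P w (k + 1) (w k ω) ∂P

/-- The value of information `e_kᵀ A_kᵀ Γ_{k+1} A_k e_k - θ_k + ϱ_k` for `e_k = e`. -/
def voi (k : ℕ) (e : Vec n) : ℝ :=
  quad ((D.A k)ᵀ * D.Γ (k + 1) * D.A k) e - D.θ k + rho D P w k e

/-- The triggering policy `δ_k = 1{VoI_k ≥ 0}`, evaluated at `e_k = x_k - x̂_k`. -/
def triggerStar (Se : Type*) : TriggerPolicy n m Se :=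
  fun k _ x δ u =>
    haveI := Classical.propDecidable
    decide (0 ≤ voi D P w k (x (Fin.last k) - D.estimate k (signals x δ) u))

end VoI

/-- The control policy `u_k = -L_k x̂_k`. -/
def controlStar (D : Data n m) (Sc : Type*) : ControlPolicy n m Sc :=
  fun k _ z u => -(D.L k *ᵥ D.estimate k z u)

/-- `(π, μ)` is a Nash equilibrium of the team game with policy sets `G₁`, `G₂` and common
cost `J`. -/
def IsNashEquilibrium {T₁ T₂ : Type*} (G₁ : Set T₁) (G₂ : Set T₂) (J : T₁ → T₂ → EReal)
    (π : T₁) (μ : T₂) : Prop :=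
  π ∈ G₁ ∧ μ ∈ G₂ ∧ (∀ π' ∈ G₁, J π μ ≤ J π' μ) ∧ ∀ μ' ∈ G₂, J π μ ≤ J π μ'

end EventTrig

end

namespace EventTrig

variable {n m : ℕ}

/-! ### Quadratic forms and the Riccati recursion -/

/-! Completing squares along a trajectory (`sum_quad_eq`) and averaging, when the controls are
square-integrable, gives the cost as a policy-free constant plus the expectations of (u_k + L_k
x_k)ᵀ Λ_k (u_k + L_k x_k) and of θ_k δ_k. Here u_k + L_k x_k = (u_k + L_k x̂_k) + L_k e_k and Γ_k =
L_kᵀ Λ_k L_k. The error obeys e_{k+1} = (1 - δ_k) A_k e_k + w_k, in which the control does not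
appear (`err_succ`).

Against u_k = -L_k x̂_k only e_kᵀ Γ_k e_k and the communication price remain: a dynamic program in
the error, with value functions V_k. VoI_k is the cost of silence minus the cost of transmission
(`voi_eq`), so the threshold rule is optimal (`triggerValue_le`, `triggerValue_eq`). Its value is
the same against every control policy.

Against the threshold rule the matter is the cross term between u_k + L_k x̂_k, which the controller
knows, and L_k e_k. It vanishes because (information, e_k) and (information, -e_k) have the same law
(`map_info_neg_err`): V_k is even and the noise symmetric, so silence does not reveal the sign of
the error, while transmission leaves only fresh noise in the next error. Dropping the square of u_k
+ L_k x̂_k gives the bound. A control policy of infinite cost needs no argument, and finite cost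
forces square-integrable controls because R_k is positive definite.

Both deviations are thus bounded below by `optimalCost`, which the pair attains. The same symmetry
makes x̂_k the conditional mean. -/

lemma quad_nonneg {M : Matrix (Fin n) (Fin n) ℝ} (h : M.PosSemidef) (x : Vec n) :
    0 ≤ quad M x := by
  simpa [quad] using h.dotProduct_mulVec_nonneg x

lemma quad_neg (M : Matrix (Fin n) (Fin n) ℝ) (x : Vec n) : quad M (-x) = quad M x := by
  simp [quad, Matrix.mulVec_neg]

lemma quad_zero_left (x : Vec n) : quad 0 x = 0 := by simp [quad]

lemma dotProduct_mulVec_symm {M : Matrix (Fin n) (Fin n) ℝ} (h : Mᵀ = M) (x y : Vec n) :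
    x ⬝ᵥ (M *ᵥ y) = y ⬝ᵥ (M *ᵥ x) := by
  conv_lhs => rw [← h]
  rw [Matrix.mulVec_transpose, dotProduct_comm, Matrix.dotProduct_mulVec]

lemma quad_add {M : Matrix (Fin n) (Fin n) ℝ} (h : Mᵀ = M) (x y : Vec n) :
    quad M (x + y) = quad M x + 2 * (y ⬝ᵥ (M *ᵥ x)) + quad M y := by
  simp only [quad, Matrix.mulVec_add, dotProduct_add, add_dotProduct,
    dotProduct_mulVec_symm h x y]
  ring

lemma quad_mulVec {k l : ℕ} (M : Matrix (Fin k) (Fin k) ℝ) (C : Matrix (Fin k) (Fin l) ℝ)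
    (x : Vec l) : quad M (C *ᵥ x) = quad (Cᵀ * M * C) x := by
  rw [quad, quad, ← Matrix.mulVec_mulVec, ← Matrix.mulVec_mulVec, Matrix.mulVec_transpose,
    dotProduct_comm x, ← Matrix.dotProduct_mulVec, dotProduct_comm]

lemma quad_add_left (M M' : Matrix (Fin n) (Fin n) ℝ) (x : Vec n) :
    quad (M + M') x = quad M x + quad M' x := by
  simp [quad, Matrix.add_mulVec]

lemma quad_sub_left (M M' : Matrix (Fin n) (Fin n) ℝ) (x : Vec n) :
    quad (M - M') x = quad M x - quad M' x := by
  simp [quad, Matrix.sub_mulVec]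

lemma transpose_eq_of_posSemidef {M : Matrix (Fin n) (Fin n) ℝ} (h : M.PosSemidef) :
    Mᵀ = M := by
  simpa using h.isHermitian.eq

/-- The weight of the deviation `u + L_k x` in the completed square. -/
noncomputable def gainWeight (T : Matrix (Fin n) (Fin n) ℝ) (B : Matrix (Fin n) (Fin m) ℝ)
    (R : Matrix (Fin m) (Fin m) ℝ) : Matrix (Fin m) (Fin m) ℝ := Bᵀ * T * B + R

lemma gainWeight_posDef {T : Matrix (Fin n) (Fin n) ℝ} (hT : T.PosSemidef)
    (B : Matrix (Fin n) (Fin m) ℝ) {R : Matrix (Fin m) (Fin m) ℝ} (hR : R.PosDef) :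
    (gainWeight T B R).PosDef := by
  have := hT.conjTranspose_mul_mul_same B
  simpa [gainWeight] using hR.posSemidef_add this

/-- The weight cancels one of the two inverses. This identity makes the error penalty Γ_k the
Λ_k-weight of L_k e. -/
lemma gain_transpose_mul {T : Matrix (Fin n) (Fin n) ℝ} (hT : T.PosSemidef)
    (A : Matrix (Fin n) (Fin n) ℝ) (B : Matrix (Fin n) (Fin m) ℝ)
    {R : Matrix (Fin m) (Fin m) ℝ} (hR : R.PosDef) :
    ((gainWeight T B R)⁻¹ * Bᵀ * T * A)ᵀ * gainWeight T B R
        * ((gainWeight T B R)⁻¹ * Bᵀ * T * A)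
      = Aᵀ * T * B * (gainWeight T B R)⁻¹ * Bᵀ * T * A := by
  have hΛ := gainWeight_posDef hT B hR
  have hu : IsUnit (gainWeight T B R).det := hΛ.det_pos.ne'.isUnit
  have hs : (gainWeight T B R)ᵀ = gainWeight T B R := transpose_eq_of_posSemidef hΛ.posSemidef
  have hTs := transpose_eq_of_posSemidef hT
  simp only [Matrix.transpose_mul, Matrix.transpose_nonsing_inv, hs, hTs,
    Matrix.transpose_transpose, Matrix.mul_assoc]
  rw [Matrix.mul_nonsing_inv_cancel_left _ _ hu]

/-- Completion of the square in one step of linear-quadratic dynamic programming. -/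
lemma quad_completion {T : Matrix (Fin n) (Fin n) ℝ} (hT : T.PosSemidef)
    (A : Matrix (Fin n) (Fin n) ℝ) (B : Matrix (Fin n) (Fin m) ℝ)
    {R : Matrix (Fin m) (Fin m) ℝ} (hR : R.PosDef) (x : Vec n) (u : Vec m) :
    quad T (A *ᵥ x + B *ᵥ u) + quad R u
      = quad (Aᵀ * T * A - Aᵀ * T * B * (gainWeight T B R)⁻¹ * Bᵀ * T * A) x
        + quad (gainWeight T B R) (u + ((gainWeight T B R)⁻¹ * Bᵀ * T * A) *ᵥ x) := by
  have hΛ := gainWeight_posDef hT B hR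
  have hu : IsUnit (gainWeight T B R).det := hΛ.det_pos.ne'.isUnit
  have hs : (gainWeight T B R)ᵀ = gainWeight T B R := transpose_eq_of_posSemidef hΛ.posSemidef
  have hTs := transpose_eq_of_posSemidef hT
  rw [quad_add hTs, quad_add hs, quad_mulVec _ _ x, quad_mulVec _ _ u, quad_mulVec _ _ x,
    gain_transpose_mul hT A B hR, quad_sub_left]
  have h1 : quad (gainWeight T B R) u = quad (Bᵀ * T * B) u + quad R u := quad_add_left _ _ _
  have h2 : (((gainWeight T B R)⁻¹ * Bᵀ * T * A) *ᵥ x) ⬝ᵥ (gainWeight T B R *ᵥ u)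
      = (B *ᵥ u) ⬝ᵥ (T *ᵥ (A *ᵥ x)) := by
    rw [dotProduct_mulVec_symm hs, Matrix.mulVec_mulVec, Matrix.mul_assoc, Matrix.mul_assoc,
      Matrix.mul_nonsing_inv_cancel_left _ _ hu, ← Matrix.mulVec_mulVec, ← Matrix.mulVec_mulVec,
      Matrix.mulVec_transpose, dotProduct_comm, ← Matrix.dotProduct_mulVec, dotProduct_comm]
  rw [h1, h2]
  ring

/-- The control -Gx, with G the gain, annihilates the completed square, so the form at x equals a
sum of two nonnegative costs. -/
lemma riccati_step_posSemidef {T : Matrix (Fin n) (Fin n) ℝ} (hT : T.PosSemidef)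
    (A : Matrix (Fin n) (Fin n) ℝ) (B : Matrix (Fin n) (Fin m) ℝ)
    {R : Matrix (Fin m) (Fin m) ℝ} (hR : R.PosDef) :
    (Aᵀ * T * A - Aᵀ * T * B * (gainWeight T B R)⁻¹ * Bᵀ * T * A).PosSemidef := by
  have hΛ := gainWeight_posDef hT B hR
  refine Matrix.PosSemidef.of_dotProduct_mulVec_nonneg ?_ fun x => ?_
  · have hs : (gainWeight T B R)ᵀ = gainWeight T B R :=
      transpose_eq_of_posSemidef hΛ.posSemidef
    have hTs := transpose_eq_of_posSemidef hT
    simp [Matrix.IsHermitian, Matrix.transpose_nonsing_inv, hs, hTs, Matrix.mul_assoc]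
  · have h := quad_completion hT A B hR x (-(((gainWeight T B R)⁻¹ * Bᵀ * T * A) *ᵥ x))
    have h1 := quad_nonneg hT (A *ᵥ x + B *ᵥ (-(((gainWeight T B R)⁻¹ * Bᵀ * T * A) *ᵥ x)))
    have h2 := quad_nonneg hR.posSemidef (-(((gainWeight T B R)⁻¹ * Bᵀ * T * A) *ᵥ x))
    have h3 : quad (gainWeight T B R) 0 = 0 := by simp [quad]
    rw [neg_add_cancel, h3, add_zero] at h
    change 0 ≤ quad _ x
    linarith

variable {D : Data n m}

lemma riccatiBack_succ (j : ℕ) :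
    D.riccatiBack (j + 1) = D.Q (D.N - j)
      + ((D.A (D.N - j))ᵀ * D.riccatiBack j * D.A (D.N - j)
        - (D.A (D.N - j))ᵀ * D.riccatiBack j * D.B (D.N - j)
          * (gainWeight (D.riccatiBack j) (D.B (D.N - j)) (D.R (D.N - j)))⁻¹
          * (D.B (D.N - j))ᵀ * D.riccatiBack j * D.A (D.N - j)) := by
  simp only [Data.riccatiBack, gainWeight]
  abel

lemma riccatiBack_posSemidef (hD : D.WellPosed) (j : ℕ) : (D.riccatiBack j).PosSemidef := by
  induction j with
  | zero => exact hD.posSemidef_Q _ le_rfl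
  | succ j ih =>
    rw [riccatiBack_succ]
    exact (hD.posSemidef_Q _ (by omega)).add
      (riccati_step_posSemidef ih _ _ (hD.posDef_R _ (by omega)))

lemma S_posSemidef (hD : D.WellPosed) (k : ℕ) : (D.S k).PosSemidef :=
  riccatiBack_posSemidef hD _

/-- `Λ_k = B_kᵀ S_{k+1} B_k + R_k`. -/
noncomputable def Data.Lam (D : Data n m) (k : ℕ) : Matrix (Fin m) (Fin m) ℝ :=
  gainWeight (D.S (k + 1)) (D.B k) (D.R k)

lemma Lam_posDef (hD : D.WellPosed) {k : ℕ} (hk : k ≤ D.N) : (D.Lam k).PosDef :=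
  gainWeight_posDef (S_posSemidef hD _) _ (hD.posDef_R k hk)

lemma S_eq {k : ℕ} (hk : k ≤ D.N) :
    D.S k = D.Q k + ((D.A k)ᵀ * D.S (k + 1) * D.A k - D.Γ k) := by
  have h1 : D.N + 1 - k = (D.N - k) + 1 := by omega
  have h2 : D.N + 1 - (k + 1) = D.N - k := by omega
  have h3 : D.N - (D.N - k) = k := by omega
  rw [Data.S, h1, riccatiBack_succ, h3, Data.Γ, if_pos hk, Data.S, h2, gainWeight]

lemma quad_Gamma (hD : D.WellPosed) {k : ℕ} (hk : k ≤ D.N) (e : Vec n) :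
    quad (D.Γ k) e = quad (D.Lam k) (D.L k *ᵥ e) := by
  rw [quad_mulVec, Data.Γ, if_pos hk]
  exact congrArg (quad · e)
    (gain_transpose_mul (S_posSemidef hD _) _ _ (hD.posDef_R k hk)).symm

/-- Read off the Riccati equation, Γ_k = Q_k + A_kᵀ S_{k+1} A_k - S_k is a combination of symmetric
matrices. -/
lemma Gamma_transpose (hD : D.WellPosed) (k : ℕ) : (D.Γ k)ᵀ = D.Γ k := by
  by_cases hk : k ≤ D.N
  · have h : D.Γ k = D.Q k + (D.A k)ᵀ * D.S (k + 1) * D.A k - D.S k := by rw [S_eq hk]; abel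
    rw [h]
    simp only [Matrix.transpose_sub, Matrix.transpose_add, Matrix.transpose_mul,
      transpose_eq_of_posSemidef (S_posSemidef hD _), Matrix.transpose_transpose,
      transpose_eq_of_posSemidef (hD.posSemidef_Q k (by omega)), Matrix.mul_assoc]
  · simp [Data.Γ, hk]

lemma quad_Gamma_nonneg (hD : D.WellPosed) (k : ℕ) (e : Vec n) : 0 ≤ quad (D.Γ k) e := by
  by_cases hk : k ≤ D.N
  · rw [quad_Gamma hD hk]
    exact quad_nonneg (Lam_posDef hD hk).posSemidef _
  · simp [Data.Γ, hk, quad_zero_left]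

/-- A pathwise identity: the noise leaves its own quadratic term and a cross term linear in w, which
disappears only after averaging. -/
lemma quad_S_step (hD : D.WellPosed) {k : ℕ} (hk : k ≤ D.N) (x : Vec n) (u : Vec m)
    (w : Vec n) :
    quad (D.S (k + 1)) (D.A k *ᵥ x + D.B k *ᵥ u + w) + (quad (D.Q k) x + quad (D.R k) u)
      = quad (D.S k) x + (quad (D.Lam k) (u + D.L k *ᵥ x) + quad (D.S (k + 1)) w
        + 2 * (w ⬝ᵥ (D.S (k + 1) *ᵥ (D.A k *ᵥ x + D.B k *ᵥ u)))) := by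
  have hS := S_posSemidef hD (k + 1)
  have h := quad_completion hS (D.A k) (D.B k) (hD.posDef_R k hk) x u
  rw [quad_add (transpose_eq_of_posSemidef hS), S_eq hk, quad_add_left]
  have hΓ : D.Γ k = (D.A k)ᵀ * D.S (k + 1) * D.B k * (gainWeight (D.S (k + 1)) (D.B k) (D.R k))⁻¹
      * (D.B k)ᵀ * D.S (k + 1) * D.A k := by rw [Data.Γ, if_pos hk, gainWeight]
  have hL : D.L k = (gainWeight (D.S (k + 1)) (D.B k) (D.R k))⁻¹ * (D.B k)ᵀ * D.S (k + 1) * D.A k :=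
    rfl
  rw [← hΓ, ← hL] at h
  rw [Data.Lam]
  linarith

/-- The quadratic cost along a trajectory, rewritten by completion of squares. -/
lemma sum_quad_eq (hD : D.WellPosed) {x w : ℕ → Vec n} {u : ℕ → Vec m}
    (hx : ∀ k, x (k + 1) = D.A k *ᵥ x k + D.B k *ᵥ u k + w k) :
    quad (D.Q (D.N + 1)) (x (D.N + 1))
        + ∑ k ∈ Finset.range (D.N + 1), (quad (D.Q k) (x k) + quad (D.R k) (u k))
      = quad (D.S 0) (x 0) + ∑ k ∈ Finset.range (D.N + 1),
          (quad (D.Lam k) (u k + D.L k *ᵥ x k) + quad (D.S (k + 1)) (w k)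
            + 2 * (w k ⬝ᵥ (D.S (k + 1) *ᵥ (D.A k *ᵥ x k + D.B k *ᵥ u k)))) := by
  have key : ∀ j ≤ D.N + 1, quad (D.S j) (x j)
        + ∑ k ∈ Finset.range j, (quad (D.Q k) (x k) + quad (D.R k) (u k))
      = quad (D.S 0) (x 0) + ∑ k ∈ Finset.range j,
          (quad (D.Lam k) (u k + D.L k *ᵥ x k) + quad (D.S (k + 1)) (w k)
            + 2 * (w k ⬝ᵥ (D.S (k + 1) *ᵥ (D.A k *ᵥ x k + D.B k *ᵥ u k)))) := by
    intro j
    induction j with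
    | zero => simp
    | succ j ih =>
      intro hj
      have h1 := ih (by omega)
      have h2 := quad_S_step hD (k := j) (by omega) (x j) (u j) (w j)
      rw [← hx] at h2
      rw [Finset.sum_range_succ, Finset.sum_range_succ]
      linarith
  have h := key _ le_rfl
  have hS : D.S (D.N + 1) = D.Q (D.N + 1) := by simp [Data.S, Data.riccatiBack]
  rwa [hS] at h

/-! ### Closed-loop recursions -/

variable {Ω Se Sc : Type*} {p : Primitives n Ω Se Sc} {π : TriggerPolicy n m Se}
  {μ : ControlPolicy n m Sc}

/-- The controls `u_0, …, u_{k-1}`. -/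
def controls (D : Data n m) (p : Primitives n Ω Se Sc) (π : TriggerPolicy n m Se)
    (μ : ControlPolicy n m Sc) (k : ℕ) (ω : Ω) : Fin k → Vec m := (hist D p π μ k ω).2.2

/-- The estimation error `e_k = x_k - x̂_k`. -/
noncomputable def err (D : Data n m) (p : Primitives n Ω Se Sc) (π : TriggerPolicy n m Se)
    (μ : ControlPolicy n m Sc) (k : ℕ) (ω : Ω) : Vec n :=
  state D p π μ k ω - xhat D p π μ k ω

lemma state_zero (ω : Ω) : state D p π μ 0 ω = p.x₀ ω := rfl

lemma hist_succ (k : ℕ) (ω : Ω) :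
    hist D p π μ (k + 1) ω =
      (Fin.snoc (α := fun _ => Vec n) (hist D p π μ k ω).1
          (D.A k *ᵥ state D p π μ k ω + D.B k *ᵥ control D p π μ k ω + p.w k ω),
        Fin.snoc (α := fun _ => Bool) (hist D p π μ k ω).2.1 (event D p π μ k ω),
        Fin.snoc (α := fun _ => Vec m) (hist D p π μ k ω).2.2 (control D p π μ k ω)) := rfl

lemma state_succ (k : ℕ) (ω : Ω) : state D p π μ (k + 1) ω
    = D.A k *ᵥ state D p π μ k ω + D.B k *ᵥ control D p π μ k ω + p.w k ω := by
  rw [state, hist_succ]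
  exact Fin.snoc_last (α := fun _ => Vec n) _ _

lemma received_succ (k : ℕ) (ω : Ω) : received D p π μ (k + 1) ω
    = Fin.snoc (α := fun _ => Signal n) (received D p π μ k ω)
      (emit (state D p π μ k ω) (event D p π μ k ω)) := by
  rw [received, hist_succ]
  funext t
  refine Fin.lastCases ?_ (fun t => ?_) t
  · simp only [signals, Fin.snoc_last, Fin.snoc_castSucc]
    rfl
  · simp only [signals, Fin.snoc_castSucc]
    rfl

lemma controls_succ (k : ℕ) (ω : Ω) : controls D p π μ (k + 1) ω
    = Fin.snoc (α := fun _ => Vec m) (controls D p π μ k ω) (control D p π μ k ω) := rfl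

lemma xhat_eq (k : ℕ) (ω : Ω) :
    xhat D p π μ k ω = D.estimate k (received D p π μ k ω) (controls D p π μ k ω) := rfl

lemma control_eq (k : ℕ) (ω : Ω) :
    control D p π μ k ω = μ k (p.η ω) (received D p π μ k ω) (controls D p π μ k ω) := rfl

lemma xhat_succ (k : ℕ) (ω : Ω) : xhat D p π μ (k + 1) ω
    = D.A k *ᵥ xhat D p π μ k ω + D.B k *ᵥ control D p π μ k ω
      + if event D p π μ k ω then D.A k *ᵥ err D p π μ k ω else 0 := by
  rw [xhat_eq, received_succ, controls_succ]
  simp only [Data.estimate, Fin.init_snoc, Fin.snoc_last, ← xhat_eq]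
  cases event D p π μ k ω <;> simp [emit, err]

lemma xhat_eq_sub (k : ℕ) :
    xhat D p π μ k = state D p π μ k - err D p π μ k := by
  funext ω
  simp [err]

lemma err_zero (ω : Ω) : err D p π μ 0 ω = p.x₀ ω - D.m₀ := rfl

/-- The control enters the state and the estimate through the same term B_k u_k and cancels; the
choice of control affects the error only through the events. -/
lemma err_succ (k : ℕ) (ω : Ω) : err D p π μ (k + 1) ω
    = (if event D p π μ k ω then 0 else D.A k *ᵥ err D p π μ k ω) + p.w k ω := by
  rw [err, state_succ, xhat_succ]
  cases event D p π μ k ω <;> simp [err, Matrix.mulVec_sub] <;> abel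

lemma event_triggerStar [MeasurableSpace Ω] (P : Measure Ω) (k : ℕ) (ω : Ω) :
    event D p (triggerStar D P p.w Se) μ k ω = true
      ↔ 0 ≤ voi D P p.w k (err D p (triggerStar D P p.w Se) μ k ω) := by
  simp [event, triggerStar, err, state, xhat, received]

lemma control_controlStar (k : ℕ) (ω : Ω) :
    control D p π (controlStar D Sc) k ω
      = -(D.L k *ᵥ xhat D p π (controlStar D Sc) k ω) := rfl

/-! ### Measurability -/

section Measurability

variable {α : Type*} {mα : MeasurableSpace α}

lemma measurable_mulVec {k l : ℕ} (M : Matrix (Fin k) (Fin l) ℝ) {f : α → Vec l}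
    (hf : Measurable f) : Measurable fun a => M *ᵥ f a :=
  (Continuous.matrix_mulVec continuous_const continuous_id).measurable.comp hf

lemma measurable_dotProduct {k : ℕ} {f g : α → Vec k} (hf : Measurable f) (hg : Measurable g) :
    Measurable fun a => f a ⬝ᵥ g a := by
  simp only [dotProduct]
  fun_prop

lemma measurable_quad {k : ℕ} (M : Matrix (Fin k) (Fin k) ℝ) {f : α → Vec k}
    (hf : Measurable f) : Measurable fun a => quad M (f a) :=
  measurable_dotProduct hf (measurable_mulVec M hf)

lemma measurable_snoc {β : Type*} [MeasurableSpace β] {k : ℕ} {f : α → Fin k → β} {g : α → β}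
    (hf : Measurable f) (hg : Measurable g) :
    Measurable fun a => Fin.snoc (α := fun _ => β) (f a) (g a) := by
  refine measurable_pi_lambda _ fun t => ?_
  refine Fin.lastCases ?_ (fun t => ?_) t
  · simpa only [Fin.snoc_last] using hg
  · simpa only [Fin.snoc_castSucc] using measurable_pi_iff.1 hf t

lemma measurable_init {β : Type*} [MeasurableSpace β] {k : ℕ} :
    Measurable fun f : Fin (k + 1) → β => (Fin.init f : Fin k → β) :=
  measurable_pi_lambda _ fun t => measurable_pi_apply t.castSucc

lemma measurable_emit {f : α → Vec n} {g : α → Bool} (hf : Measurable f) (hg : Measurable g) :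
    Measurable fun a => emit (f a) (g a) := by
  unfold emit
  exact Measurable.ite (hg (measurableSet_singleton true)) (measurable_inl.comp hf)
    measurable_const

lemma measurable_signals {k : ℕ} {f : α → Fin (k + 1) → Vec n} {g : α → Fin k → Bool}
    (hf : Measurable f) (hg : Measurable g) : Measurable fun a => signals (f a) (g a) :=
  measurable_pi_lambda _ fun t =>
    measurable_emit (measurable_pi_iff.1 hf t.castSucc) (measurable_pi_iff.1 hg t)

lemma measurable_estimate_uncurry (D : Data n m) (k : ℕ) :
    Measurable fun q : (Fin k → Signal n) × (Fin k → Vec m) => D.estimate k q.1 q.2 := by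
  induction k with
  | zero => exact measurable_const
  | succ k ih =>
    have h1 : Measurable fun q : (Fin (k + 1) → Signal n) × (Fin (k + 1) → Vec m) =>
        D.estimate k (Fin.init q.1) (Fin.init q.2) :=
      ih.comp ((measurable_init.comp measurable_fst).prodMk (measurable_init.comp measurable_snd))
    have hz : Measurable fun q : (Fin (k + 1) → Signal n) × (Fin (k + 1) → Vec m) =>
        q.1 (Fin.last k) := (measurable_pi_apply _).comp measurable_fst
    have hu : Measurable fun q : (Fin (k + 1) → Signal n) × (Fin (k + 1) → Vec m) =>
        q.2 (Fin.last k) := (measurable_pi_apply _).comp measurable_snd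
    -- The case distinction on the signal becomes an indicator times a function of the decoded
    -- value; the value 0 assigned to the empty symbol is killed by the indicator.
    have hval : Measurable (Sum.elim id fun _ => 0 : Signal n → Vec n) :=
      Measurable.sumElim measurable_id measurable_const
    have hind : Measurable (Sum.elim (fun _ => 1) fun _ => 0 : Signal n → ℝ) :=
      Measurable.sumElim measurable_const measurable_const
    have h2 : Measurable fun q : (Fin (k + 1) → Signal n) × (Fin (k + 1) → Vec m) =>
        (Sum.elim (fun _ => 1) fun _ => 0 : Signal n → ℝ) (q.1 (Fin.last k)) •
          (D.A k *ᵥ ((Sum.elim id fun _ => 0 : Signal n → Vec n) (q.1 (Fin.last k))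
            - D.estimate k (Fin.init q.1) (Fin.init q.2))) :=
      (hind.comp hz).smul (measurable_mulVec _ ((hval.comp hz).sub h1))
    convert ((measurable_mulVec (D.A k) h1).add (measurable_mulVec (D.B k) hu)).add h2 using 2
      with q
    simp only [Data.estimate, Pi.add_apply]
    cases q.1 (Fin.last k) <;> simp

lemma measurable_estimate (D : Data n m) {k : ℕ} {f : α → Fin k → Signal n}
    {g : α → Fin k → Vec m} (hf : Measurable f) (hg : Measurable g) :
    Measurable fun a => D.estimate k (f a) (g a) :=
  (measurable_estimate_uncurry D k).comp (hf.prodMk hg)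

end Measurability

/-! ### The closed loop as a measurable function of the primitive variables -/

section History

variable {Se Sc : Type*} {D : Data n m} {π : TriggerPolicy n m Se} {μ : ControlPolicy n m Sc}

lemma measurable_history [MeasurableSpace Se] [MeasurableSpace Sc]
    (hπ : π ∈ admissibleTrigger n m Se) (hμ : μ ∈ admissibleControl n m Sc) (k : ℕ) :
    Measurable fun q : Sc × Se × Vec n × (ℕ → Vec n) =>
      D.history π μ q.2.1 q.1 q.2.2.1 q.2.2.2 k := by
  induction k with
  | zero =>
    refine Measurable.prodMk ?_ (Measurable.prodMk measurable_const measurable_const)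
    exact measurable_pi_lambda _ fun _ => measurable_fst.comp (measurable_snd.comp measurable_snd)
  | succ k ih =>
    have h1 := ih.fst
    have h2 := ih.snd.fst
    have h3 := ih.snd.snd
    have hδ := (hπ k).comp (measurable_snd.fst.prodMk (h1.prodMk (h2.prodMk h3)))
    have hu := (hμ k).comp (measurable_fst.prodMk ((measurable_signals h1 h2).prodMk h3))
    have hx := measurable_pi_iff.1 h1 (Fin.last k)
    have hw : Measurable fun q : Sc × Se × Vec n × (ℕ → Vec n) => q.2.2.2 k :=
      (measurable_pi_apply k).comp measurable_snd.snd.snd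
    exact (measurable_snoc h1
      (((measurable_mulVec _ hx).add (measurable_mulVec _ hu)).add hw)).prodMk
        ((measurable_snoc h2 hδ).prodMk (measurable_snoc h3 hu))

/-- Causality: noise from time k onward may be altered freely, which is how independence from w_k is
obtained. -/
lemma history_congr {s : Se} {c : Sc} {x₀ : Vec n} {w w' : ℕ → Vec n} {k : ℕ}
    (h : ∀ t < k, w t = w' t) :
    D.history π μ s c x₀ w k = D.history π μ s c x₀ w' k := by
  induction k with
  | zero => rfl
  | succ k ih =>
    have hk := h k (Nat.lt_succ_self k)
    simp only [Data.history, ih fun t ht => h t (ht.trans (Nat.lt_succ_self k)), hk]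

end History

section ClosedLoop

variable {Ω Se Sc : Type*} [MeasurableSpace Ω] [MeasurableSpace Se] [MeasurableSpace Sc]
  {D : Data n m} {P : Measure Ω} {p : Primitives n Ω Se Sc}
  {π : TriggerPolicy n m Se} {μ : ControlPolicy n m Sc}

lemma Primitives.HasLaws.measurable_noise (hp : p.HasLaws D P) :
    Measurable fun ω t => p.w t ω :=
  measurable_pi_lambda _ hp.measurable_w

lemma measurable_hist (hp : p.HasLaws D P) (hπ : π ∈ admissibleTrigger n m Se)
    (hμ : μ ∈ admissibleControl n m Sc) (k : ℕ) : Measurable (hist D p π μ k) :=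
  (measurable_history hπ hμ k).comp (hp.measurable_η.prodMk (hp.measurable_ξ.prodMk
    (hp.measurable_x₀.prodMk hp.measurable_noise)))

lemma measurable_state (hp : p.HasLaws D P) (hπ : π ∈ admissibleTrigger n m Se)
    (hμ : μ ∈ admissibleControl n m Sc) (k : ℕ) : Measurable (state D p π μ k) :=
  measurable_pi_iff.1 (measurable_hist hp hπ hμ k).fst (Fin.last k)

lemma measurable_received (hp : p.HasLaws D P) (hπ : π ∈ admissibleTrigger n m Se)
    (hμ : μ ∈ admissibleControl n m Sc) (k : ℕ) : Measurable (received D p π μ k) :=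
  measurable_signals (measurable_hist hp hπ hμ k).fst (measurable_hist hp hπ hμ k).snd.fst

lemma measurable_controls (hp : p.HasLaws D P) (hπ : π ∈ admissibleTrigger n m Se)
    (hμ : μ ∈ admissibleControl n m Sc) (k : ℕ) : Measurable (controls D p π μ k) :=
  (measurable_hist hp hπ hμ k).snd.snd

lemma measurable_event (hp : p.HasLaws D P) (hπ : π ∈ admissibleTrigger n m Se)
    (hμ : μ ∈ admissibleControl n m Sc) (k : ℕ) : Measurable (event D p π μ k) :=
  (hπ k).comp (hp.measurable_ξ.prodMk (measurable_hist hp hπ hμ k))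

lemma measurable_control (hp : p.HasLaws D P) (hπ : π ∈ admissibleTrigger n m Se)
    (hμ : μ ∈ admissibleControl n m Sc) (k : ℕ) : Measurable (control D p π μ k) :=
  (hμ k).comp (hp.measurable_η.prodMk ((measurable_received hp hπ hμ k).prodMk
    (measurable_controls hp hπ hμ k)))

lemma measurable_xhat (hp : p.HasLaws D P) (hπ : π ∈ admissibleTrigger n m Se)
    (hμ : μ ∈ admissibleControl n m Sc) (k : ℕ) : Measurable (xhat D p π μ k) :=
  measurable_estimate D (measurable_received hp hπ hμ k) (measurable_controls hp hπ hμ k)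

lemma measurable_err (hp : p.HasLaws D P) (hπ : π ∈ admissibleTrigger n m Se)
    (hμ : μ ∈ admissibleControl n m Sc) (k : ℕ) : Measurable (err D p π μ k) :=
  (measurable_state hp hπ hμ k).sub (measurable_xhat hp hπ hμ k)

end ClosedLoop

/-! ### Independence of the noise and the past -/

/-- The joint law of the triple is a product, which is then reassociated. This allows the initial
state and the seeds to be adjoined to the past noise one at a time. -/
lemma indepFun_prodMk_left_of_indepFun {Ω α β γ : Type*} [MeasurableSpace Ω]
    [MeasurableSpace α] [MeasurableSpace β] [MeasurableSpace γ] {P : Measure Ω}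
    [IsProbabilityMeasure P] {X : Ω → α} {Y : Ω → β} {Z : Ω → γ} (hX : Measurable X)
    (hY : Measurable Y) (hZ : Measurable Z) (hXYZ : IndepFun X (fun ω => (Y ω, Z ω)) P)
    (hYZ : IndepFun Y Z P) : IndepFun (fun ω => (X ω, Y ω)) Z P := by
  have hXY : IndepFun X Y P := hXYZ.comp measurable_id measurable_fst
  have := Measure.isProbabilityMeasure_map (μ := P) hX.aemeasurable
  have := Measure.isProbabilityMeasure_map (μ := P) hY.aemeasurable
  have := Measure.isProbabilityMeasure_map (μ := P) hZ.aemeasurable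
  rw [indepFun_iff_map_prod_eq_prod_map_map (hX.prodMk hY).aemeasurable hZ.aemeasurable]
  rw [indepFun_iff_map_prod_eq_prod_map_map hX.aemeasurable hY.aemeasurable] at hXY
  rw [indepFun_iff_map_prod_eq_prod_map_map hY.aemeasurable hZ.aemeasurable] at hYZ
  rw [indepFun_iff_map_prod_eq_prod_map_map hX.aemeasurable (hY.prodMk hZ).aemeasurable,
    hYZ] at hXYZ
  have h := (measurePreserving_prodAssoc (P.map X) (P.map Y) (P.map Z)).symm
  rw [hXY, ← h.map_eq, ← hXYZ, Measure.map_map (MeasurableEquiv.measurable _)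
    (hX.prodMk (hY.prodMk hZ))]
  rfl

section Independence

variable {Ω Se Sc : Type*} [MeasurableSpace Ω] [MeasurableSpace Se] [MeasurableSpace Sc]
  {D : Data n m} {P : Measure Ω} [IsProbabilityMeasure P] {p : Primitives n Ω Se Sc}
  {π : TriggerPolicy n m Se} {μ : ControlPolicy n m Sc}

lemma indepFun_past_noise (hp : p.HasLaws D P) (k : ℕ) :
    IndepFun (fun ω => (p.η ω, p.ξ ω, p.x₀ ω, fun t => if t < k then p.w t ω else 0))
      (p.w k) P := by
  -- The past noise is kept as a full sequence, set to zero from time k on, so that it can be fed to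
  -- `history`.
  have hpast : Measurable fun ω t => if t < k then p.w t ω else 0 := by
    refine measurable_pi_lambda _ fun t => ?_
    by_cases h : t < k <;> simp only [h, if_true, if_false]
    exacts [hp.measurable_w t, measurable_const]
  have htrunc : Measurable fun w : ℕ → Vec n => ((fun t => if t < k then w t else 0, w k) :
      (ℕ → Vec n) × Vec n) := by
    refine Measurable.prodMk (measurable_pi_lambda _ fun t => ?_) (measurable_pi_apply k)
    by_cases h : t < k <;> simp only [h, if_true, if_false]
    exacts [measurable_pi_apply t, measurable_const]
  have h0 : IndepFun (fun ω t => if t < k then p.w t ω else 0) (p.w k) P := by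
    have h := hp.indep_w.indepFun_finset (Finset.range k) {k} (by simp) hp.measurable_w
    have hf : Measurable fun (v : (i : Finset.range k) → Vec n) (t : ℕ) =>
        if ht : t ∈ Finset.range k then v ⟨t, ht⟩ else 0 := by
      refine measurable_pi_lambda _ fun t => ?_
      by_cases ht : t ∈ Finset.range k <;> simp only [ht, dif_pos, dif_neg, not_false_eq_true]
      exacts [measurable_pi_apply _, measurable_const]
    have hg : Measurable fun v : (i : ({k} : Finset ℕ)) → Vec n =>
        v ⟨k, Finset.mem_singleton_self k⟩ := measurable_pi_apply _
    convert h.comp hf hg using 1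
    · funext ω t
      simp
    · rfl
  have h1 := indepFun_prodMk_left_of_indepFun hp.measurable_x₀ hpast (hp.measurable_w k)
    (hp.indep_x₀.comp measurable_id htrunc) h0
  have h2 := indepFun_prodMk_left_of_indepFun hp.measurable_ξ (hp.measurable_x₀.prodMk hpast)
    (hp.measurable_w k)
    (hp.indep_ξ.comp measurable_id ((measurable_fst.prodMk (htrunc.comp measurable_snd).fst).prodMk
      (htrunc.comp measurable_snd).snd)) h1
  exact indepFun_prodMk_left_of_indepFun hp.measurable_η
    (hp.measurable_ξ.prodMk (hp.measurable_x₀.prodMk hpast)) (hp.measurable_w k)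
    (hp.indep_η.comp measurable_id ((measurable_fst.prodMk (measurable_snd.fst.prodMk
      (htrunc.comp measurable_snd.snd).fst)).prodMk (htrunc.comp measurable_snd.snd).snd)) h2

/-- The noise at time `k` is independent of the seeds and of the history up to time `k`. -/
lemma indepFun_hist_noise (hp : p.HasLaws D P) (hπ : π ∈ admissibleTrigger n m Se)
    (hμ : μ ∈ admissibleControl n m Sc) (k : ℕ) :
    IndepFun (fun ω => (p.η ω, p.ξ ω, hist D p π μ k ω)) (p.w k) P := by
  have h := (indepFun_past_noise hp k).comp (measurable_fst.prodMk (measurable_snd.fst.prodMk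
    (measurable_history (D := D) hπ hμ k))) measurable_id
  have heq : (fun ω => (p.η ω, p.ξ ω, hist D p π μ k ω)) =
      (fun q : Sc × Se × Vec n × (ℕ → Vec n) =>
        (q.1, q.2.1, D.history π μ q.2.1 q.1 q.2.2.1 q.2.2.2 k)) ∘
      fun ω => (p.η ω, p.ξ ω, p.x₀ ω, fun t => if t < k then p.w t ω else 0) := by
    funext ω
    have hw : ∀ t < k, p.w t ω = if t < k then p.w t ω else 0 := fun t ht => by simp [ht]
    simp only [Function.comp_apply, hist, history_congr hw]
  rw [heq]
  exact h

end Independence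

/-! ### Symmetry of centred Gaussian vectors -/

/-- The characteristic functional of a centred Gaussian law depends only on the variances of linear
functionals, and these ignore signs. No density is used, so a singular covariance is allowed. -/
lemma map_neg_eq_of_isGaussianVec {Ω : Type*} [MeasurableSpace Ω] {P : Measure Ω}
    [IsProbabilityMeasure P] {X : Ω → Vec n} {a : Vec n} {M : Matrix (Fin n) (Fin n) ℝ}
    (hX : Measurable X) (h : IsGaussianVec P X a M) :
    P.map (fun ω => -(X ω - a)) = P.map fun ω => X ω - a := by
  have := h.1.isGaussian_map
  have hν : P.map (fun ω => X ω - a) = (P.map X).map fun x => x - a := by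
    rw [Measure.map_map (by fun_prop) hX]; rfl
  have hint : Integrable X P := h.1.integrable
  have hmean : ∫ ω, X ω ∂P = a := by
    funext i
    rw [eval_integral fun i => hint.eval i, h.2.1 i]
  have : IsGaussian (P.map fun ω => X ω - a) := hν ▸ inferInstance
  have h0 : (P.map fun ω => X ω - a)[id] = 0 := by
    rw [integral_map (hX.sub_const a).aemeasurable (by fun_prop)]
    simp only [id]
    rw [integral_sub hint (integrable_const a), hmean]
    simp
  have hneg : P.map (fun ω => -(X ω - a))
      = (P.map fun ω => X ω - a).map (-ContinuousLinearMap.id ℝ (Vec n)) := by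
    rw [Measure.map_map (by fun_prop) (hX.sub_const a)]; rfl
  have : IsGaussian (P.map (fun ω => -(X ω - a))) := hneg ▸ inferInstance
  refine Measure.ext_of_charFunDual (funext fun L => ?_)
  rw [hneg, charFunDual_map, IsGaussian.charFunDual_eq_of_integral_eq_zero h0,
    IsGaussian.charFunDual_eq_of_integral_eq_zero h0]
  have : ⇑(L.comp (-ContinuousLinearMap.id ℝ (Vec n))) = -⇑L := by
    ext x; simp
  rw [this, variance_neg]

/-! ### Square integrability -/

section SquareIntegrable

variable {Ω : Type*} [MeasurableSpace Ω] {P : Measure Ω}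

lemma memLp_mulVec {k l : ℕ} (M : Matrix (Fin k) (Fin l) ℝ) {f : Ω → Vec l}
    (hf : MemLp f 2 P) : MemLp (fun ω => M *ᵥ f ω) 2 P :=
  (LinearMap.toContinuousLinearMap (Matrix.mulVecLin M)).comp_memLp' hf

lemma integrable_dotProduct {k : ℕ} {f g : Ω → Vec k} (hf : MemLp f 2 P) (hg : MemLp g 2 P) :
    Integrable (fun ω => f ω ⬝ᵥ g ω) P := by
  simp only [dotProduct]
  exact integrable_finsetSum _ fun i _ => (hf.eval i).integrable_mul (hg.eval i)

lemma integrable_quad {k : ℕ} (M : Matrix (Fin k) (Fin k) ℝ) {f : Ω → Vec k}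
    (hf : MemLp f 2 P) : Integrable (fun ω => quad M (f ω)) P :=
  integrable_dotProduct hf (memLp_mulVec M hf)

lemma integral_dotProduct_eq_zero {k : ℕ} [IsProbabilityMeasure P] {W Y : Ω → Vec k}
    (hW : MemLp W 2 P) (hY : MemLp Y 2 P) (hWY : IndepFun Y W P) (h0 : ∀ i, ∫ ω, W ω i ∂P = 0) :
    ∫ ω, W ω ⬝ᵥ Y ω ∂P = 0 := by
  simp only [dotProduct]
  have hint : ∀ i, Integrable (fun ω => W ω i * Y ω i) P := fun i =>
    (hW.eval i).integrable_mul (hY.eval i)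
  rw [integral_finsetSum _ fun i _ => hint i]
  refine Finset.sum_eq_zero fun i _ => ?_
  have h : IndepFun (fun ω => W ω i) (fun ω => Y ω i) P :=
    hWY.symm.comp (measurable_pi_apply i) (measurable_pi_apply i)
  rw [h.integral_fun_mul_eq_mul_integral (hW.eval i).aestronglyMeasurable
    (hY.eval i).aestronglyMeasurable, h0 i, zero_mul]

/-- The form attains a positive minimum on the compact unit sphere, and homogeneity extends the
bound to all vectors. -/
lemma exists_mul_sq_norm_le_quad {k : ℕ} {M : Matrix (Fin k) (Fin k) ℝ} (hM : M.PosDef) :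
    ∃ c > 0, ∀ x : Vec k, c * ‖x‖ ^ 2 ≤ quad M x := by
  have hpos : ∀ x : Vec k, x ≠ 0 → 0 < quad M x := fun x hx => by
    simpa [quad] using hM.dotProduct_mulVec_pos hx
  have hcont : Continuous fun x : Vec k => quad M x := by
    unfold quad
    exact continuous_id.dotProduct (Continuous.matrix_mulVec continuous_const continuous_id)
  have hhom : ∀ (t : ℝ) (x : Vec k), quad M (t • x) = t ^ 2 * quad M x := fun t x => by
    simp only [quad, Matrix.mulVec_smul, smul_dotProduct, dotProduct_smul, smul_eq_mul]
    ring
  rcases (Metric.sphere (0 : Vec k) 1).eq_empty_or_nonempty with he | hne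
  -- An empty sphere forces every vector to be zero (dimension 0), so any positive constant serves.
  · refine ⟨1, one_pos, fun x => ?_⟩
    have hx : x = 0 := by
      by_contra hx
      have : ‖x‖⁻¹ • x ∈ Metric.sphere (0 : Vec k) 1 := by
        simp [norm_smul, hx]
      simp [he] at this
    simp [hx, quad]
  · obtain ⟨y, hy, hmin⟩ := (isCompact_sphere (0 : Vec k) 1).exists_isMinOn hne hcont.continuousOn
    have hy1 : ‖y‖ = 1 := by simpa using hy
    refine ⟨quad M y, hpos y (by rintro rfl; simp at hy1), fun x => ?_⟩
    by_cases hx : x = 0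
    · simp [hx, quad]
    · have hmem : ‖x‖⁻¹ • x ∈ Metric.sphere (0 : Vec k) 1 := by simp [norm_smul, hx]
      have h := hmin hmem
      have hn : 0 < ‖x‖ := norm_pos_iff.2 hx
      change quad M y ≤ quad M (‖x‖⁻¹ • x) at h
      rw [hhom, inv_pow] at h
      calc quad M y * ‖x‖ ^ 2 ≤ ((‖x‖ ^ 2)⁻¹ * quad M x) * ‖x‖ ^ 2 := by gcongr
        _ = quad M x := by field_simp

lemma memLp_of_integrable_quad {k : ℕ} {M : Matrix (Fin k) (Fin k) ℝ} (hM : M.PosDef)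
    {f : Ω → Vec k} (hf : AEStronglyMeasurable f P) (h : Integrable (fun ω => quad M (f ω)) P) :
    MemLp f 2 P := by
  obtain ⟨c, hc, hle⟩ := exists_mul_sq_norm_le_quad hM
  rw [memLp_two_iff_integrable_sq_norm hf]
  refine (h.const_mul c⁻¹).mono' (hf.norm.pow 2) (ae_of_all _ fun ω => ?_)
  rw [Real.norm_of_nonneg (by positivity), le_inv_mul_iff₀ hc]
  exact hle _

end SquareIntegrable

/-! ### The value function of the event trigger -/

section Value

variable {Ω Se Sc : Type*} [MeasurableSpace Ω] [MeasurableSpace Se] [MeasurableSpace Sc]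
  {D : Data n m} {P : Measure Ω} {p : Primitives n Ω Se Sc}

lemma Primitives.HasLaws.memLp_w (hp : p.HasLaws D P) (k : ℕ) : MemLp (p.w k) 2 P :=
  (hp.gaussian_w k).1.memLp_two

lemma Primitives.HasLaws.memLp_x₀ (hp : p.HasLaws D P) : MemLp p.x₀ 2 P :=
  hp.gaussian_x₀.1.memLp_two

/-- The expected cost-to-go from time `k + 1` when the error is `y + w_k` at that time. -/
noncomputable def costToGo (D : Data n m) (P : Measure Ω) (w : ℕ → Ω → Vec n) (k : ℕ)
    (y : Vec n) : ℝ :=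
  ∫ ω, (quad (D.Γ (k + 1)) (y + w k ω) + value D P w (k + 1) (y + w k ω)) ∂P

/-- Truncated subtraction sends every time past the horizon to the terminal function, so later
statements hold for all k. -/
lemma value_of_lt {w : ℕ → Ω → Vec n} {k : ℕ} (hk : D.N < k) : value D P w k = 0 := by
  funext e
  rw [value, show D.N + 1 - k = 0 by omega]
  rfl

lemma value_eq_min (D : Data n m) (P : Measure Ω) (w : ℕ → Ω → Vec n) {k : ℕ} (hk : k ≤ D.N)
    (e : Vec n) : value D P w k e
      = min (costToGo D P w k (D.A k *ᵥ e)) (D.θ k + costToGo D P w k 0) := by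
  have h1 : D.N + 1 - k = (D.N - k) + 1 := by omega
  have h2 : D.N + 1 - (k + 1) = D.N - k := by omega
  have h3 : D.N - (D.N - k) = k := by omega
  simp only [value, costToGo, h1, h2, valueBack, h3, zero_add]

/-- Backward induction on time for statements about the value functions. -/
lemma value_induction {w : ℕ → Ω → Vec n} {motive : (Vec n → ℝ) → Prop} (h0 : motive 0)
    (hstep : ∀ k ≤ D.N, motive (value D P w (k + 1)) → motive (value D P w k)) (k : ℕ) :
    motive (value D P w k) := by
  by_cases hk : D.N < k
  · rwa [value_of_lt hk]
  · refine Nat.decreasingInduction (n := D.N + 1) (motive := fun k _ => motive (value D P w k))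
      (fun k hk ih => hstep k (by omega) ih) ?_ (by omega : k ≤ D.N + 1)
    rwa [value_of_lt (Nat.lt_succ_self _)]

/-- Evenness of f moves the sign from y to W, and the symmetry of W absorbs it. -/
lemma integral_shift_neg {f : Vec n → ℝ} (hf : Measurable f) (hfe : ∀ e, f (-e) = f e)
    {W : Ω → Vec n} (hW : Measurable W) (hneg : P.map (fun ω => -W ω) = P.map W) (y : Vec n) :
    ∫ ω, f (-y + W ω) ∂P = ∫ ω, f (y + W ω) ∂P := by
  have hm : Measurable fun v => f (y + v) := hf.comp (measurable_id.const_add y)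
  calc ∫ ω, f (-y + W ω) ∂P = ∫ ω, f (y + -W ω) ∂P := by
        congr 1; funext ω; rw [← hfe]; congr 1; abel
    _ = ∫ v, f (y + v) ∂(P.map fun ω => -W ω) :=
        (integral_map hW.neg.aemeasurable hm.aestronglyMeasurable).symm
    _ = ∫ v, f (y + v) ∂(P.map W) := by rw [hneg]
    _ = _ := integral_map hW.aemeasurable hm.aestronglyMeasurable

variable [IsProbabilityMeasure P]

lemma Primitives.HasLaws.map_neg_w (hp : p.HasLaws D P) (k : ℕ) :
    P.map (fun ω => -p.w k ω) = P.map (p.w k) := by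
  simpa using map_neg_eq_of_isGaussianVec (hp.measurable_w k) (hp.gaussian_w k)

lemma measurable_integral_shift {f : Vec n → ℝ} (hf : Measurable f) {W : Ω → Vec n}
    (hW : Measurable W) : Measurable fun y => ∫ ω, f (y + W ω) ∂P := by
  have h : Measurable fun q : Vec n × Ω => f (q.1 + W q.2) :=
    hf.comp (measurable_fst.add (hW.comp measurable_snd))
  exact h.stronglyMeasurable.integral_prod_right'.measurable

lemma measurable_value (hp : p.HasLaws D P) (k : ℕ) : Measurable (value D P p.w k) := by
  refine value_induction (motive := fun f => Measurable f) measurable_const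
    (fun k hk ih => ?_) k
  have hc : Measurable fun e => costToGo D P p.w k e :=
    measurable_integral_shift ((measurable_quad _ measurable_id).add ih) (hp.measurable_w k)
  simp only [funext (value_eq_min D P p.w hk)]
  exact (hc.comp (measurable_mulVec _ measurable_id)).min measurable_const

/-- The transmission branch does not depend on e and bounds the minimum above; nonnegativity of the
Γ-penalty carries a lower bound backward in time. Boundedness then settles integrability of the
value functions along every policy. -/
lemma exists_abs_value_le (hD : D.WellPosed) (w : ℕ → Ω → Vec n) (k : ℕ) :
    ∃ C, ∀ e, |value D P w k e| ≤ C := by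
  refine value_induction (motive := fun f => ∃ C, ∀ e, |f e| ≤ C) ⟨0, by simp⟩
    (fun k hk ih => ?_) k
  obtain ⟨C, hC⟩ := ih
  have hC0 : 0 ≤ C := (abs_nonneg _).trans (hC 0)
  -- If the integrand is not integrable, the Bochner integral is 0 and the bound still holds.
  have hlow : ∀ y, -C ≤ costToGo D P w k y := by
    intro y
    by_cases hi : Integrable (fun ω => quad (D.Γ (k + 1)) (y + w k ω)
        + value D P w (k + 1) (y + w k ω)) P
    · calc -C = ∫ _, -C ∂P := by simp
        _ ≤ _ := integral_mono (integrable_const _) hi fun ω => by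
          have h1 := quad_Gamma_nonneg hD (k + 1) (y + w k ω)
          have h2 := (abs_le.1 (hC (y + w k ω))).1
          dsimp only
          linarith
    · rw [costToGo, integral_undef hi]
      linarith
  refine ⟨C + |D.θ k| + |costToGo D P w k 0|, fun e => ?_⟩
  rw [value_eq_min D P w hk, abs_le]
  have h1 := hlow (D.A k *ᵥ e)
  have h2 := hlow 0
  have h3 := abs_le.1 (le_refl |D.θ k|)
  have h4 := abs_le.1 (le_refl |costToGo D P w k 0|)
  refine ⟨le_min (by linarith) (by linarith), (min_le_right _ _).trans (by linarith)⟩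

lemma integrable_value_comp (hD : D.WellPosed) (hp : p.HasLaws D P) (k : ℕ) {f : Ω → Vec n}
    (hf : Measurable f) : Integrable (fun ω => value D P p.w k (f ω)) P := by
  obtain ⟨C, hC⟩ := exists_abs_value_le (P := P) hD p.w k
  exact Integrable.of_bound ((measurable_value hp k).comp hf).aestronglyMeasurable C
    (ae_of_all _ fun ω => hC _)

lemma value_neg (hp : p.HasLaws D P) (k : ℕ) (e : Vec n) :
    value D P p.w k (-e) = value D P p.w k e := by
  refine value_induction (motive := fun f => ∀ e, f (-e) = f e) (by simp) (fun k hk ih e => ?_) k e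
  rw [value_eq_min D P p.w hk, value_eq_min D P p.w hk, Matrix.mulVec_neg]
  congr 1
  exact integral_shift_neg
    (f := fun v => quad (D.Γ (k + 1)) v + value D P p.w (k + 1) v)
    ((measurable_quad _ measurable_id).add (measurable_value hp _))
    (fun v => by rw [quad_neg, ih]) (hp.measurable_w k) (hp.map_neg_w k) _

lemma rho_neg (hp : p.HasLaws D P) (k : ℕ) (e : Vec n) :
    rho D P p.w k (-e) = rho D P p.w k e := by
  rw [rho, rho, Matrix.mulVec_neg]
  congr 1
  exact integral_shift_neg (measurable_value hp _) (value_neg hp _) (hp.measurable_w k)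
    (hp.map_neg_w k) _

lemma voi_neg (hp : p.HasLaws D P) (k : ℕ) (e : Vec n) :
    voi D P p.w k (-e) = voi D P p.w k e := by
  rw [voi, voi, quad_neg, rho_neg hp]

lemma measurable_voi (hp : p.HasLaws D P) (k : ℕ) : Measurable (voi D P p.w k) :=
  ((measurable_quad _ measurable_id).sub_const _).add
    (((measurable_integral_shift (measurable_value hp _) (hp.measurable_w k)).comp
      (measurable_mulVec _ measurable_id)).sub_const _)

lemma integral_quad_shift (hD : D.WellPosed) (hp : p.HasLaws D P) (k j : ℕ) (y : Vec n) :
    ∫ ω, quad (D.Γ j) (y + p.w k ω) ∂P = quad (D.Γ j) y + ∫ ω, quad (D.Γ j) (p.w k ω) ∂P := by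
  have hw := hp.memLp_w k
  have hc : MemLp (fun _ : Ω => D.Γ j *ᵥ y) 2 P := memLp_const _
  have h0 : ∫ ω, p.w k ω ⬝ᵥ (D.Γ j *ᵥ y) ∂P = 0 :=
    integral_dotProduct_eq_zero hw hc (indepFun_const_left _ _) fun i => (hp.gaussian_w k).2.1 i
  simp only [quad_add (Gamma_transpose hD j) y]
  have hd := (integrable_dotProduct hw hc).const_mul 2
  have hs : Integrable (fun ω => quad (D.Γ j) y + 2 * (p.w k ω ⬝ᵥ (D.Γ j *ᵥ y))) P :=
    (integrable_const _).add hd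
  rw [integral_add hs (integrable_quad _ hw), integral_add (integrable_const _) hd,
    integral_const_mul, h0]
  simp

/-- The value of information is the difference of the costs of silence and of transmission. -/
lemma voi_eq (hD : D.WellPosed) (hp : p.HasLaws D P) (k : ℕ) (e : Vec n) :
    voi D P p.w k e
      = costToGo D P p.w k (D.A k *ᵥ e) - (D.θ k + costToGo D P p.w k 0) := by
  have hsplit : ∀ y, costToGo D P p.w k y = quad (D.Γ (k + 1)) y
      + ∫ ω, quad (D.Γ (k + 1)) (p.w k ω) ∂P + ∫ ω, value D P p.w (k + 1) (y + p.w k ω) ∂P := by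
    intro y
    have hy : MemLp (fun ω => y + p.w k ω) 2 P := (memLp_const y).add (hp.memLp_w k)
    rw [costToGo, integral_add (integrable_quad _ hy)
      (integrable_value_comp hD hp _ ((hp.measurable_w k).const_add y)),
      integral_quad_shift hD hp]
  have h0 : quad (D.Γ (k + 1)) 0 = 0 := by simp [quad]
  rw [hsplit, hsplit, voi, rho, quad_mulVec, h0]
  simp only [zero_add]
  ring

end Value

/-! ### Dynamic programming for the event trigger -/

section DynamicProgramming

variable {Ω Se Sc : Type*} [MeasurableSpace Ω] [MeasurableSpace Se] [MeasurableSpace Sc]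
  {D : Data n m} {P : Measure Ω} {p : Primitives n Ω Se Sc}
  {π : TriggerPolicy n m Se} {μ : ControlPolicy n m Sc}

lemma measurableSet_event (hp : p.HasLaws D P) (hπ : π ∈ admissibleTrigger n m Se)
    (hμ : μ ∈ admissibleControl n m Sc) (k : ℕ) :
    MeasurableSet {ω | event D p π μ k ω = true} :=
  measurable_event hp hπ hμ k (measurableSet_singleton true)

lemma controlStar_admissible (D : Data n m) :
    controlStar D Sc ∈ admissibleControl n m Sc := fun k =>
  (measurable_mulVec (D.L k)
    (measurable_estimate D measurable_snd.fst measurable_snd.snd)).neg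

/-- The part of the error at time `k + 1` that is known at time `k`. -/
noncomputable def residual (D : Data n m) (p : Primitives n Ω Se Sc) (π : TriggerPolicy n m Se)
    (μ : ControlPolicy n m Sc) (k : ℕ) (ω : Ω) : Vec n :=
  if event D p π μ k ω then 0 else D.A k *ᵥ err D p π μ k ω

lemma measurable_residual (hp : p.HasLaws D P) (hπ : π ∈ admissibleTrigger n m Se)
    (hμ : μ ∈ admissibleControl n m Sc) (k : ℕ) : Measurable (residual D p π μ k) :=
  Measurable.ite (measurableSet_event hp hπ hμ k) measurable_const
    (measurable_mulVec _ (measurable_err hp hπ hμ k))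

lemma memLp_ite (hp : p.HasLaws D P) (hπ : π ∈ admissibleTrigger n m Se)
    (hμ : μ ∈ admissibleControl n m Sc) (k : ℕ) {f g : Ω → Vec n} (hf : MemLp f 2 P)
    (hg : MemLp g 2 P) :
    MemLp (fun ω => if event D p π μ k ω then f ω else g ω) 2 P := by
  have hs := measurableSet_event hp hπ hμ k
  convert (hf.indicator hs).add (hg.indicator hs.compl) using 1
  funext ω
  by_cases h : event D p π μ k ω = true <;> simp [Set.indicator, h]

variable [IsProbabilityMeasure P]

lemma triggerStar_admissible (hp : p.HasLaws D P) :
    triggerStar D P p.w Se ∈ admissibleTrigger n m Se := by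
  intro k
  have hv : Measurable fun h : Se × (Fin (k + 1) → Vec n) × (Fin k → Bool) × (Fin k → Vec m) =>
      voi D P p.w k (h.2.1 (Fin.last k) - D.estimate k (signals h.2.1 h.2.2.1) h.2.2.2) :=
    (measurable_voi hp k).comp ((measurable_pi_iff.1 measurable_snd.fst _).sub
      (measurable_estimate D (measurable_signals measurable_snd.fst measurable_snd.snd.fst)
        measurable_snd.snd.snd))
  refine measurable_to_bool ?_
  convert measurableSet_le (measurable_const (a := (0 : ℝ))) hv using 1
  ext h
  simp [triggerStar]

/-- This covers even control policies of infinite cost, since the recursion for the error contains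
no control. -/
lemma memLp_err (hp : p.HasLaws D P) (hπ : π ∈ admissibleTrigger n m Se)
    (hμ : μ ∈ admissibleControl n m Sc) (k : ℕ) : MemLp (err D p π μ k) 2 P := by
  induction k with
  | zero => exact hp.memLp_x₀.sub (memLp_const _)
  | succ k ih =>
    simp only [funext (err_succ (D := D) (p := p) (π := π) (μ := μ) k)]
    exact (memLp_ite hp hπ hμ k (memLp_const 0) (memLp_mulVec _ ih)).add (hp.memLp_w k)

/-- Fubini for the product law: W is averaged with Y frozen, which replaces conditioning on the
past. -/
lemma integral_add_of_indepFun {Y W : Ω → Vec n} (hY : Measurable Y) (hW : Measurable W)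
    (hYW : IndepFun Y W P) {f : Vec n → ℝ} (hf : Measurable f)
    (hi : Integrable (fun ω => f (Y ω + W ω)) P) :
    Integrable (fun ω => ∫ ω', f (Y ω + W ω') ∂P) P ∧
      ∫ ω, f (Y ω + W ω) ∂P = ∫ ω, ∫ ω', f (Y ω + W ω') ∂P ∂P := by
  have h := (indepFun_iff_map_prod_eq_prod_map_map hY.aemeasurable hW.aemeasurable).1 hYW
  have := Measure.isProbabilityMeasure_map (μ := P) hY.aemeasurable
  have := Measure.isProbabilityMeasure_map (μ := P) hW.aemeasurable
  have hg : Measurable fun q : Vec n × Vec n => f (q.1 + q.2) :=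
    hf.comp (measurable_fst.add measurable_snd)
  have hi' : Integrable (fun q : Vec n × Vec n => f (q.1 + q.2)) ((P.map Y).prod (P.map W)) := by
    rw [← h, integrable_map_measure hg.aestronglyMeasurable (hY.prodMk hW).aemeasurable]
    exact hi
  have hinner : ∀ y, ∫ v, f (y + v) ∂(P.map W) = ∫ ω', f (y + W ω') ∂P := fun y =>
    integral_map hW.aemeasurable (hf.comp (measurable_id.const_add y)).aestronglyMeasurable
  have hm : Measurable fun y => ∫ ω', f (y + W ω') ∂P := measurable_integral_shift hf hW
  constructor
  · have h1 := hi'.integral_prod_left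
    simp only [hinner] at h1
    rwa [integrable_map_measure hm.aestronglyMeasurable hY.aemeasurable] at h1
  · calc ∫ ω, f (Y ω + W ω) ∂P = ∫ q, f (q.1 + q.2) ∂(P.map fun ω => (Y ω, W ω)) :=
          (integral_map (hY.prodMk hW).aemeasurable hg.aestronglyMeasurable).symm
      _ = ∫ y, ∫ v, f (y + v) ∂(P.map W) ∂(P.map Y) := by rw [h, integral_prod _ hi']
      _ = _ := by
        simp only [hinner]
        exact integral_map hY.aemeasurable hm.aestronglyMeasurable

lemma measurable_residual_of_hist (hπ : π ∈ admissibleTrigger n m Se) (D : Data n m) (k : ℕ) :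
    Measurable fun q : Sc × Se × (Fin (k + 1) → Vec n) × (Fin k → Bool) × (Fin k → Vec m) =>
      if π k q.2.1 q.2.2.1 q.2.2.2.1 q.2.2.2.2 then 0
      else D.A k *ᵥ (q.2.2.1 (Fin.last k)
        - D.estimate k (signals q.2.2.1 q.2.2.2.1) q.2.2.2.2) :=
  Measurable.ite ((hπ k).comp measurable_snd (measurableSet_singleton true)) measurable_const
    (measurable_mulVec _ ((measurable_pi_iff.1 measurable_snd.snd.fst _).sub
      (measurable_estimate D (measurable_signals measurable_snd.snd.fst
        measurable_snd.snd.snd.fst) measurable_snd.snd.snd.snd)))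

lemma indepFun_residual_noise (hp : p.HasLaws D P) (hπ : π ∈ admissibleTrigger n m Se)
    (hμ : μ ∈ admissibleControl n m Sc) (k : ℕ) :
    IndepFun (residual D p π μ k) (p.w k) P :=
  (indepFun_hist_noise hp hπ hμ k).comp (measurable_residual_of_hist hπ D k) measurable_id

/-- The indicator of a transmission. -/
noncomputable def transmit (D : Data n m) (p : Primitives n Ω Se Sc) (π : TriggerPolicy n m Se)
    (μ : ControlPolicy n m Sc) (k : ℕ) (ω : Ω) : ℝ :=
  if event D p π μ k ω then 1 else 0

lemma integrable_transmit (hp : p.HasLaws D P) (hπ : π ∈ admissibleTrigger n m Se)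
    (hμ : μ ∈ admissibleControl n m Sc) (k : ℕ) :
    Integrable (transmit D p π μ k) P := by
  refine Integrable.of_bound (Measurable.ite (measurableSet_event hp hπ hμ k) measurable_const
    measurable_const).aestronglyMeasurable 1 (ae_of_all _ fun ω => ?_)
  by_cases h : event D p π μ k ω = true <;> simp [transmit, h]

/-- The communication cost plus the penalty of the error at time `k + 1`. -/
noncomputable def stageCost (D : Data n m) (p : Primitives n Ω Se Sc) (π : TriggerPolicy n m Se)
    (μ : ControlPolicy n m Sc) (k : ℕ) (ω : Ω) : ℝ :=
  D.θ k * transmit D p π μ k ω + quad (D.Γ (k + 1)) (err D p π μ (k + 1) ω)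

/-- Averaging over w_k with the residual frozen is the one-step Bellman identity, valid for
arbitrary admissible policies. -/
lemma integral_stageCost_add_value (hD : D.WellPosed) (hp : p.HasLaws D P)
    (hπ : π ∈ admissibleTrigger n m Se) (hμ : μ ∈ admissibleControl n m Sc) (k : ℕ) :
    Integrable (fun ω => D.θ k * transmit D p π μ k ω
        + costToGo D P p.w k (residual D p π μ k ω)) P ∧
    ∫ ω, stageCost D p π μ k ω ∂P + ∫ ω, value D P p.w (k + 1) (err D p π μ (k + 1) ω) ∂P
      = ∫ ω, (D.θ k * transmit D p π μ k ω + costToGo D P p.w k (residual D p π μ k ω)) ∂P := by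
  have hq := integrable_quad (D.Γ (k + 1)) (memLp_err hp hπ hμ (k + 1))
  have hv := integrable_value_comp hD hp (k + 1) (measurable_err hp hπ hμ (k + 1))
  have ht := (integrable_transmit hp hπ hμ k).const_mul (D.θ k)
  have h := integral_add_of_indepFun (P := P)
    (f := fun v => quad (D.Γ (k + 1)) v + value D P p.w (k + 1) v)
    (measurable_residual hp hπ hμ k) (hp.measurable_w k) (indepFun_residual_noise hp hπ hμ k)
    ((measurable_quad _ measurable_id).add (measurable_value hp _))
    (by
      have h := hq.add hv
      simp only [funext (err_succ (D := D) (p := p) (π := π) (μ := μ) k)] at h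
      exact h)
  have hc : Integrable (fun ω => costToGo D P p.w k (residual D p π μ k ω)) P := h.1
  refine ⟨ht.add hc, ?_⟩
  rw [integral_add ht hc]
  unfold stageCost
  rw [integral_add ht hq, add_assoc, ← integral_add hq hv]
  congr 1
  simp only [err_succ]
  exact h.2

/-- The residual is 0 after transmission and A_k e_k after silence, so the integrand is pointwise
one of the two branches of the minimum. -/
lemma integral_value_le (hD : D.WellPosed) (hp : p.HasLaws D P)
    (hπ : π ∈ admissibleTrigger n m Se) (hμ : μ ∈ admissibleControl n m Sc) {k : ℕ}
    (hk : k ≤ D.N) :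
    ∫ ω, value D P p.w k (err D p π μ k ω) ∂P ≤
      ∫ ω, stageCost D p π μ k ω ∂P
        + ∫ ω, value D P p.w (k + 1) (err D p π μ (k + 1) ω) ∂P := by
  obtain ⟨hi, h⟩ := integral_stageCost_add_value hD hp hπ hμ k
  rw [h]
  refine integral_mono (integrable_value_comp hD hp k (measurable_err hp hπ hμ k)) hi fun ω => ?_
  simp only [value_eq_min D P p.w hk, transmit, residual]
  by_cases hδ : event D p π μ k ω = true
  · simp [hδ]
  · simp [hδ]

/-- The sign of VoI_k tells which branch is smaller, so the threshold rule selects the minimum at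
every point; at a tie the branches agree. -/
lemma integral_value_eq (hD : D.WellPosed) (hp : p.HasLaws D P)
    (hμ : μ ∈ admissibleControl n m Sc) {k : ℕ} (hk : k ≤ D.N) :
    ∫ ω, value D P p.w k (err D p (triggerStar D P p.w Se) μ k ω) ∂P =
      ∫ ω, stageCost D p (triggerStar D P p.w Se) μ k ω ∂P
        + ∫ ω, value D P p.w (k + 1) (err D p (triggerStar D P p.w Se) μ (k + 1) ω) ∂P := by
  rw [(integral_stageCost_add_value hD hp (triggerStar_admissible hp) hμ k).2]
  congr 1
  funext ω
  have hstar := event_triggerStar (D := D) (p := p) (μ := μ) P k ω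
  rw [voi_eq hD hp] at hstar
  simp only [value_eq_min D P p.w hk, transmit, residual]
  by_cases hδ : event D p (triggerStar D P p.w Se) μ k ω = true
  · have := hstar.1 hδ
    simp only [hδ, if_true, mul_one]
    exact min_eq_right (by linarith)
  · have := mt hstar.2 hδ
    simp only [hδ, Bool.false_eq_true, if_false, mul_zero, zero_add]
    exact min_eq_left (by linarith [not_le.1 this])

/-- The expected optimal cost-to-go of the event trigger. -/
noncomputable def triggerValue (D : Data n m) (P : Measure Ω) (p : Primitives n Ω Se Sc) : ℝ :=
  ∫ ω, value D P p.w 0 (p.x₀ ω - D.m₀) ∂P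

lemma triggerValue_le (hD : D.WellPosed) (hp : p.HasLaws D P)
    (hπ : π ∈ admissibleTrigger n m Se) (hμ : μ ∈ admissibleControl n m Sc) :
    triggerValue D P p ≤ ∑ k ∈ Finset.range (D.N + 1), ∫ ω, stageCost D p π μ k ω ∂P := by
  have key : ∀ j ≤ D.N + 1, triggerValue D P p ≤
      ∑ k ∈ Finset.range j, ∫ ω, stageCost D p π μ k ω ∂P
        + ∫ ω, value D P p.w j (err D p π μ j ω) ∂P := by
    intro j
    induction j with
    | zero => intro _; simp [triggerValue, err_zero]
    | succ j ih =>
      intro hj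
      have h1 := ih (by omega)
      have h2 := integral_value_le hD hp hπ hμ (k := j) (by omega)
      rw [Finset.sum_range_succ]
      linarith
  simpa [value_of_lt (Nat.lt_succ_self D.N)] using key _ le_rfl

/-- The Bellman equalities telescope. The left side does not involve μ, so a deviating controller
cannot change the total stage cost of the threshold rule. -/
lemma triggerValue_eq (hD : D.WellPosed) (hp : p.HasLaws D P)
    (hμ : μ ∈ admissibleControl n m Sc) :
    triggerValue D P p = ∑ k ∈ Finset.range (D.N + 1),
      ∫ ω, stageCost D p (triggerStar D P p.w Se) μ k ω ∂P := by
  have key : ∀ j ≤ D.N + 1, triggerValue D P p =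
      ∑ k ∈ Finset.range j, ∫ ω, stageCost D p (triggerStar D P p.w Se) μ k ω ∂P
        + ∫ ω, value D P p.w j (err D p (triggerStar D P p.w Se) μ j ω) ∂P := by
    intro j
    induction j with
    | zero => intro _; simp [triggerValue, err_zero]
    | succ j ih =>
      intro hj
      have h1 := ih (by omega)
      have h2 := integral_value_eq hD hp hμ (k := j) (by omega)
      rw [Finset.sum_range_succ]
      linarith
  simpa [value_of_lt (Nat.lt_succ_self D.N)] using key _ le_rfl

end DynamicProgramming

/-! ### Symmetry of the estimation error given the controller's information -/

/-- Each map leaves s, hence its complement, invariant, so the measure of a preimage splits into the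
two pieces. -/
lemma measurePreserving_piecewise {α : Type*} [MeasurableSpace α] {ν : Measure α} {s : Set α}
    [DecidablePred (· ∈ s)] (hs : MeasurableSet s) {f g : α → α} (hf : MeasurePreserving f ν ν)
    (hg : MeasurePreserving g ν ν) (hfs : f ⁻¹' s = s) (hgs : g ⁻¹' s = s) :
    MeasurePreserving (s.piecewise f g) ν ν := by
  have hm : Measurable (s.piecewise f g) := hf.measurable.piecewise hs hg.measurable
  refine ⟨hm, Measure.ext fun t ht => ?_⟩
  rw [Measure.map_apply hm ht, ← measure_inter_add_sdiff _ hs, ← measure_inter_add_sdiff t hs]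
  congr 1
  · rw [← hf.measure_preimage (ht.inter hs).nullMeasurableSet, Set.preimage_inter, hfs]
    congr 1
    ext a
    by_cases h : a ∈ s <;> simp [h]
  · rw [← hg.measure_preimage (ht.diff hs).nullMeasurableSet, Set.preimage_sdiff, hgs]
    congr 1
    ext a
    by_cases h : a ∈ s <;> simp [h]

section InformationStep

variable {Ω Se Sc : Type*} {D : Data n m} {p : Primitives n Ω Se Sc} {μ : ControlPolicy n m Sc}

/-- The information of the controller at time `k`. -/
abbrev Info (n m : ℕ) (Sc : Type*) (k : ℕ) : Type _ :=
  Sc × (Fin k → Signal n) × (Fin k → Vec m)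

/-- The information of the controller at time `k`, as a random variable. -/
def info (D : Data n m) (p : Primitives n Ω Se Sc) (π : TriggerPolicy n m Se)
    (μ : ControlPolicy n m Sc) (k : ℕ) (ω : Ω) : Info n m Sc k :=
  (p.η ω, received D p π μ k ω, controls D p π μ k ω)

open Classical in
/-- One step of the controller's information and of the estimation error under the threshold
rule with value of information `v`. -/
noncomputable def infoStep (D : Data n m) (μ : ControlPolicy n m Sc) (v : Vec n → ℝ) (k : ℕ)
    (q : (Info n m Sc k × Vec n) × Vec n) : Info n m Sc (k + 1) × Vec n :=
  ((q.1.1.1,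
    Fin.snoc (α := fun _ => Signal n) q.1.1.2.1
      (emit (D.estimate k q.1.1.2.1 q.1.1.2.2 + q.1.2) (decide (0 ≤ v q.1.2))),
    Fin.snoc (α := fun _ => Vec m) q.1.1.2.2 (μ k q.1.1.1 q.1.1.2.1 q.1.1.2.2)),
    (if 0 ≤ v q.1.2 then 0 else D.A k *ᵥ q.1.2) + q.2)

/-- Since x_k = x̂_k + e_k, the new signal is determined by the information and the error; the pair
is therefore driven by w_k alone. -/
lemma info_err_succ [MeasurableSpace Ω] (P : Measure Ω) (k : ℕ) (ω : Ω) :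
    (info D p (triggerStar D P p.w Se) μ (k + 1) ω, err D p (triggerStar D P p.w Se) μ (k + 1) ω)
      = infoStep D μ (voi D P p.w k) k
        ((info D p (triggerStar D P p.w Se) μ k ω, err D p (triggerStar D P p.w Se) μ k ω),
          p.w k ω) := by
  have hev := event_triggerStar (D := D) (p := p) (μ := μ) P k ω
  have hx : state D p (triggerStar D P p.w Se) μ k ω = xhat D p (triggerStar D P p.w Se) μ k ω
      + err D p (triggerStar D P p.w Se) μ k ω := by rw [err]; abel
  rw [info, received_succ, controls_succ, err_succ, infoStep, hx]
  by_cases h : 0 ≤ voi D P p.w k (err D p (triggerStar D P p.w Se) μ k ω)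
  · simp [hev.2 h, h, info, xhat_eq, control_eq]
  · simp [Bool.eq_false_iff.2 (mt hev.1 h), h, info, xhat_eq, control_eq]

end InformationStep

section Symmetry

variable {Ω Se Sc : Type*} [MeasurableSpace Ω] [MeasurableSpace Se] [MeasurableSpace Sc]
  {D : Data n m} {P : Measure Ω} {p : Primitives n Ω Se Sc}
  {π : TriggerPolicy n m Se} {μ : ControlPolicy n m Sc}

lemma measurable_info (hp : p.HasLaws D P) (hπ : π ∈ admissibleTrigger n m Se)
    (hμ : μ ∈ admissibleControl n m Sc) (k : ℕ) : Measurable (info D p π μ k) :=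
  hp.measurable_η.prodMk ((measurable_received hp hπ hμ k).prodMk
    (measurable_controls hp hπ hμ k))

lemma measurable_infoStep (hμ : μ ∈ admissibleControl n m Sc) {v : Vec n → ℝ}
    (hv : Measurable v) (k : ℕ) : Measurable (infoStep D μ v k) := by
  have hI : Measurable fun q : (Info n m Sc k × Vec n) × Vec n => q.1.1 := measurable_fst.fst
  have he : Measurable fun q : (Info n m Sc k × Vec n) × Vec n => q.1.2 := measurable_fst.snd
  have hs : MeasurableSet {q : (Info n m Sc k × Vec n) × Vec n | 0 ≤ v q.1.2} :=
    measurableSet_le measurable_const (hv.comp he)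
  have hδ : Measurable fun q : (Info n m Sc k × Vec n) × Vec n =>
      @decide (0 ≤ v q.1.2) (Classical.propDecidable _) := by
    refine measurable_to_bool ?_
    convert hs using 1
    ext q
    simp
  exact (hI.fst.prodMk ((measurable_snoc hI.snd.fst (measurable_emit
    ((measurable_estimate D hI.snd.fst hI.snd.snd).add he) hδ)).prodMk
      (measurable_snoc hI.snd.snd ((hμ k).comp hI)))).prodMk
    ((Measurable.ite hs measurable_const (measurable_mulVec _ he)).add measurable_snd)

variable [IsProbabilityMeasure P]

/-- Under the threshold rule the estimation error is symmetric, jointly with the information of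
the controller, whatever the control policy. -/
lemma map_info_neg_err (hp : p.HasLaws D P) (hμ : μ ∈ admissibleControl n m Sc) (k : ℕ) :
    P.map (fun ω => (info D p (triggerStar D P p.w Se) μ k ω,
        -err D p (triggerStar D P p.w Se) μ k ω))
      = P.map fun ω => (info D p (triggerStar D P p.w Se) μ k ω,
        err D p (triggerStar D P p.w Se) μ k ω) := by
  classical
  have hπ : triggerStar D P p.w Se ∈ admissibleTrigger n m Se := triggerStar_admissible hp
  induction k with
  | zero =>
    -- At time 0 the information is only the seed, which is independent of the symmetric variable
    -- x_0 - m_0.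
    have hx : IndepFun p.x₀ p.η P := (hp.indep_η.comp measurable_id measurable_snd.fst).symm
    have he : Measurable fun ω => p.x₀ ω - D.m₀ := hp.measurable_x₀.sub_const _
    have hen : Measurable fun ω => -(p.x₀ ω - D.m₀) := he.neg
    have h1 : IndepFun p.η (fun ω => p.x₀ ω - D.m₀) P :=
      hx.symm.comp measurable_id (measurable_id.sub_const D.m₀)
    have h2 : IndepFun p.η (fun ω => -(p.x₀ ω - D.m₀)) P :=
      hx.symm.comp measurable_id (measurable_id.sub_const D.m₀).neg
    rw [indepFun_iff_map_prod_eq_prod_map_map hp.measurable_η.aemeasurable he.aemeasurable] at h1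
    rw [indepFun_iff_map_prod_eq_prod_map_map hp.measurable_η.aemeasurable hen.aemeasurable,
      map_neg_eq_of_isGaussianVec hp.measurable_x₀ hp.gaussian_x₀, ← h1] at h2
    set G : Sc × Vec n → Info n m Sc 0 × Vec n :=
      fun q => ((q.1, Fin.elim0, Fin.elim0), q.2) with hG
    have hm : Measurable G :=
      (measurable_fst.prodMk (measurable_const.prodMk measurable_const)).prodMk measurable_snd
    have h3 := congrArg (Measure.map G) h2
    rw [Measure.map_map hm (hp.measurable_η.prodMk hen),
      Measure.map_map hm (hp.measurable_η.prodMk he)] at h3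
    convert h3 using 2
    · funext ω
      simp only [info, err_zero, Function.comp_apply, hG]
      congr 3
      all_goals exact Subsingleton.elim _ _
    · funext ω
      simp only [info, err_zero, Function.comp_apply, hG]
      congr 3
      all_goals exact Subsingleton.elim _ _
  | succ k ih =>
    set I := info D p (triggerStar D P p.w Se) μ k with hI
    set e := err D p (triggerStar D P p.w Se) μ k with he
    have hIm : Measurable I := measurable_info hp hπ hμ k
    have hem : Measurable e := measurable_err hp hπ hμ k
    have hw := hp.measurable_w k
    set F := infoStep D μ (voi D P p.w k) k with hF
    have hFm : Measurable F := measurable_infoStep hμ (measurable_voi hp k) k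
    have hJm : Measurable fun ω => ((I ω, e ω), p.w k ω) := (hIm.prodMk hem).prodMk hw
    set ν := P.map fun ω => ((I ω, e ω), p.w k ω) with hν
    have hindep : IndepFun (fun ω => (I ω, e ω)) (p.w k) P := by
      have hm : Measurable fun q : Sc × Se × (Fin (k + 1) → Vec n) × (Fin k → Bool)
          × (Fin k → Vec m) => (((q.1, signals q.2.2.1 q.2.2.2.1, q.2.2.2.2),
            q.2.2.1 (Fin.last k) - D.estimate k (signals q.2.2.1 q.2.2.2.1) q.2.2.2.2) :
              Info n m Sc k × Vec n) := by
        have hz : Measurable fun q : Sc × Se × (Fin (k + 1) → Vec n) × (Fin k → Bool)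
            × (Fin k → Vec m) => signals q.2.2.1 q.2.2.2.1 :=
          measurable_signals measurable_snd.snd.fst measurable_snd.snd.snd.fst
        have hu : Measurable fun q : Sc × Se × (Fin (k + 1) → Vec n) × (Fin k → Bool)
            × (Fin k → Vec m) => q.2.2.2.2 := measurable_snd.snd.snd.snd
        exact (measurable_fst.prodMk (hz.prodMk hu)).prodMk
          ((measurable_pi_iff.1 measurable_snd.snd.fst _).sub (measurable_estimate D hz hu))
      exact (indepFun_hist_noise hp hπ hμ k).comp hm measurable_id
    have hprod : ν = (P.map fun ω => (I ω, e ω)).prod (P.map (p.w k)) :=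
      (indepFun_iff_map_prod_eq_prod_map_map (hIm.prodMk hem).aemeasurable hw.aemeasurable).1 hindep
    have := Measure.isProbabilityMeasure_map (μ := P) (hIm.prodMk hem).aemeasurable
    have := Measure.isProbabilityMeasure_map (μ := P) hw.aemeasurable
    have hnegw : MeasurePreserving (fun v : Vec n => -v) (P.map (p.w k)) (P.map (p.w k)) :=
      ⟨measurable_neg, by rw [Measure.map_map measurable_neg hw]; exact hp.map_neg_w k⟩
    have hnege : MeasurePreserving (fun q : Info n m Sc k × Vec n => (q.1, -q.2))
        (P.map fun ω => (I ω, e ω)) (P.map fun ω => (I ω, e ω)) := by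
      have hm : Measurable fun q : Info n m Sc k × Vec n => (q.1, -q.2) :=
        measurable_fst.prodMk measurable_snd.neg
      refine ⟨hm, ?_⟩
      rw [Measure.map_map hm (hIm.prodMk hem)]
      exact ih
    -- The reflection for transmission: the signal reveals e_k, so only the noise may change sign.
    have hf : MeasurePreserving (Prod.map id fun v : Vec n => -v) ν ν := by
      rw [hprod]; exact (MeasurePreserving.id _).prod hnegw
    -- The reflection for silence: the signal is empty, so error and noise change sign together.
    -- Here the induction hypothesis enters.
    have hg : MeasurePreserving
        (Prod.map (fun q : Info n m Sc k × Vec n => (q.1, -q.2)) fun v : Vec n => -v) ν ν := by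
      rw [hprod]; exact hnege.prod hnegw
    set s : Set ((Info n m Sc k × Vec n) × Vec n) := {q | 0 ≤ voi D P p.w k q.1.2} with hs
    have hsm : MeasurableSet s :=
      measurableSet_le measurable_const ((measurable_voi hp k).comp measurable_fst.snd)
    -- VoI_k is even, so the transmission region is invariant under both reflections and they can be
    -- glued.
    have hΦ := measurePreserving_piecewise hsm hf hg rfl (by
      ext q
      simp [hs, voi_neg hp])
    have hN : Measurable fun q : Info n m Sc (k + 1) × Vec n => (q.1, -q.2) :=
      measurable_fst.prodMk measurable_snd.neg
    -- Reflecting the next error amounts to reflecting the input: after transmission that error is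
    -- w_k, after silence it is A_k e_k + w_k, and the new information is unchanged in both cases.
    have hcomm : (fun q : Info n m Sc (k + 1) × Vec n => (q.1, -q.2)) ∘ F
        = F ∘ s.piecewise (Prod.map id fun v : Vec n => -v)
          (Prod.map (fun q : Info n m Sc k × Vec n => (q.1, -q.2)) fun v : Vec n => -v) := by
      funext q
      by_cases h : 0 ≤ voi D P p.w k q.1.2
      · have hq : q ∈ s := h
        simp [hF, infoStep, hq, h]
      · have hq : q ∉ s := h
        simp [hF, infoStep, hq, h, voi_neg hp, emit, Matrix.mulVec_neg, add_comm]
    have hlaw : (fun ω => (info D p (triggerStar D P p.w Se) μ (k + 1) ω,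
        err D p (triggerStar D P p.w Se) μ (k + 1) ω)) = F ∘ fun ω => ((I ω, e ω), p.w k ω) := by
      funext ω
      exact info_err_succ P k ω
    have hlaw' : (fun ω => (info D p (triggerStar D P p.w Se) μ (k + 1) ω,
        -err D p (triggerStar D P p.w Se) μ (k + 1) ω))
        = ((fun q : Info n m Sc (k + 1) × Vec n => (q.1, -q.2)) ∘ F) ∘
          fun ω => ((I ω, e ω), p.w k ω) := by
      rw [Function.comp_assoc, ← hlaw]
      rfl
    rw [hlaw', hlaw, ← Measure.map_map (hN.comp hFm) hJm, ← Measure.map_map hFm hJm, ← hν, hcomm,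
      ← Measure.map_map hFm hΦ.measurable, hΦ.map_eq]

/-- The integral equals its own negative by invariance of the law. Integrability is not needed. Real
values serve the cross term, vector values the conditional mean. -/
lemma integral_eq_zero_of_odd {E : Type*} [NormedAddCommGroup E] [NormedSpace ℝ E]
    (hp : p.HasLaws D P) (hμ : μ ∈ admissibleControl n m Sc) (k : ℕ)
    {φ : Info n m Sc k × Vec n → E} (hφ : StronglyMeasurable φ)
    (hodd : ∀ I e, φ (I, -e) = -φ (I, e)) :
    ∫ ω, φ (info D p (triggerStar D P p.w Se) μ k ω,
      err D p (triggerStar D P p.w Se) μ k ω) ∂P = 0 := by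
  have hπ : triggerStar D P p.w Se ∈ admissibleTrigger n m Se := triggerStar_admissible hp
  have hI := measurable_info hp hπ hμ k
  have he := measurable_err hp hπ hμ k
  have h1 := integral_map (hI.prodMk he).aemeasurable hφ.aestronglyMeasurable (μ := P)
  have h2 := integral_map (hI.prodMk he.neg).aemeasurable hφ.aestronglyMeasurable (μ := P)
  have h3 : ∫ ω, φ (info D p (triggerStar D P p.w Se) μ k ω,
      -err D p (triggerStar D P p.w Se) μ k ω) ∂P = ∫ ω, φ (info D p (triggerStar D P p.w Se) μ k ω,
      err D p (triggerStar D P p.w Se) μ k ω) ∂P := by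
    rw [← h1, ← map_info_neg_err hp hμ k]
    exact h2.symm
  simp only [hodd] at h3
  rw [integral_neg] at h3
  have h4 := eq_neg_iff_add_eq_zero.1 h3.symm
  rw [← two_smul ℝ] at h4
  exact (smul_eq_zero.1 h4).resolve_left two_ne_zero

/-- Under the threshold rule the estimation error is orthogonal to the controller's information. -/
lemma integral_dotProduct_err_eq_zero (hp : p.HasLaws D P) (hμ : μ ∈ admissibleControl n m Sc)
    (k : ℕ) {l : ℕ} {g : Info n m Sc k → Vec l} (hg : Measurable g)
    (C : Matrix (Fin l) (Fin n) ℝ) :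
    ∫ ω, g (info D p (triggerStar D P p.w Se) μ k ω)
      ⬝ᵥ (C *ᵥ err D p (triggerStar D P p.w Se) μ k ω) ∂P = 0 :=
  integral_eq_zero_of_odd hp hμ k (φ := fun q => g q.1 ⬝ᵥ (C *ᵥ q.2))
    (measurable_dotProduct (hg.comp measurable_fst)
      (measurable_mulVec C measurable_snd)).stronglyMeasurable
    fun I e => by simp [Matrix.mulVec_neg]

end Symmetry

/-! ### Decomposition of the cost -/

section QuadCost

variable {Ω Se Sc : Type*} {D : Data n m} {p : Primitives n Ω Se Sc}
  {π : TriggerPolicy n m Se} {μ : ControlPolicy n m Sc}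

/-- The quadratic part of the cost of a trajectory. -/
noncomputable def quadCost (D : Data n m) (p : Primitives n Ω Se Sc) (π : TriggerPolicy n m Se)
    (μ : ControlPolicy n m Sc) (ω : Ω) : ℝ :=
  quad (D.Q (D.N + 1)) (state D p π μ (D.N + 1) ω)
    + ∑ k ∈ Finset.range (D.N + 1),
      (quad (D.Q k) (state D p π μ k ω) + quad (D.R k) (control D p π μ k ω))

lemma quadCost_summand_nonneg (hD : D.WellPosed) (ω : Ω) {k : ℕ}
    (hk : k ∈ Finset.range (D.N + 1)) :
    0 ≤ quad (D.Q k) (state D p π μ k ω) + quad (D.R k) (control D p π μ k ω) := by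
  have hk' := Finset.mem_range.1 hk
  exact add_nonneg (quad_nonneg (hD.posSemidef_Q k (by omega)) _)
    (quad_nonneg (hD.posDef_R k (by omega)).posSemidef _)

lemma quadCost_nonneg (hD : D.WellPosed) (ω : Ω) : 0 ≤ quadCost D p π μ ω :=
  add_nonneg (quad_nonneg (hD.posSemidef_Q _ le_rfl) _)
    (Finset.sum_nonneg fun _ hk => quadCost_summand_nonneg hD ω hk)

end QuadCost

section Cost

variable {Ω Se Sc : Type*} [MeasurableSpace Ω] [MeasurableSpace Se] [MeasurableSpace Sc]
  {D : Data n m} {P : Measure Ω} {p : Primitives n Ω Se Sc}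
  {π : TriggerPolicy n m Se} {μ : ControlPolicy n m Sc}

/-- The part of the cost that no policy influences. -/
noncomputable def baseCost (D : Data n m) (P : Measure Ω) (p : Primitives n Ω Se Sc) : ℝ :=
  ∫ ω, quad (D.S 0) (p.x₀ ω) ∂P
    + ∑ k ∈ Finset.range (D.N + 1), ∫ ω, quad (D.S (k + 1)) (p.w k ω) ∂P

lemma measurable_quadCost (hp : p.HasLaws D P) (hπ : π ∈ admissibleTrigger n m Se)
    (hμ : μ ∈ admissibleControl n m Sc) : Measurable (quadCost D p π μ) :=
  (measurable_quad _ (measurable_state hp hπ hμ _)).add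
    (Finset.measurable_fun_sum _ fun _ _ => (measurable_quad _ (measurable_state hp hπ hμ _)).add
      (measurable_quad _ (measurable_control hp hπ hμ _)))

lemma memLp_state (hp : p.HasLaws D P) {j : ℕ}
    (hu : ∀ k < j, MemLp (control D p π μ k) 2 P) : MemLp (state D p π μ j) 2 P := by
  induction j with
  | zero => exact hp.memLp_x₀
  | succ j ih =>
    simp only [funext (state_succ (D := D) (p := p) (π := π) (μ := μ) j)]
    exact ((memLp_mulVec _ (ih fun k hk => hu k (hk.trans (Nat.lt_succ_self j)))).add
      (memLp_mulVec _ (hu j (Nat.lt_succ_self j)))).add (hp.memLp_w j)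

lemma integrable_quadCost (hp : p.HasLaws D P)
    (hu : ∀ k ≤ D.N, MemLp (control D p π μ k) 2 P) : Integrable (quadCost D p π μ) P := by
  refine (integrable_quad _ (memLp_state hp fun k hk => hu k (by omega))).add
    (integrable_finsetSum _ fun k hk => ?_)
  have hk' := Finset.mem_range.1 hk
  exact (integrable_quad _ (memLp_state hp fun j hj => hu j (by omega))).add
    (integrable_quad _ (hu k (by omega)))

/-- A finite cost forces square-integrable controls. -/
lemma memLp_control_of_cost_ne_top (hD : D.WellPosed) (hp : p.HasLaws D P)
    (hπ : π ∈ admissibleTrigger n m Se) (hμ : μ ∈ admissibleControl n m Sc)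
    (h : cost D p π μ P ≠ ⊤) {k : ℕ} (hk : k ≤ D.N) : MemLp (control D p π μ k) 2 P := by
  -- The communication part is a finite real, so an infinite quadratic part would make the whole
  -- cost infinite.
  have hfin : ∫⁻ ω, ENNReal.ofReal (quadCost D p π μ ω) ∂P ≠ ⊤ := by
    intro htop
    apply h
    unfold cost
    unfold quadCost at htop
    rw [htop, EReal.coe_ennreal_top, EReal.top_add_coe]
  have hi : Integrable (quadCost D p π μ) P :=
    (lintegral_ofReal_ne_top_iff_integrable
      (measurable_quadCost hp hπ hμ).aestronglyMeasurable
      (ae_of_all _ (quadCost_nonneg hD))).1 hfin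
  have hum := measurable_control hp hπ hμ k
  refine memLp_of_integrable_quad (hD.posDef_R k hk) hum.aestronglyMeasurable
    (hi.mono' (measurable_quad _ hum).aestronglyMeasurable (ae_of_all _ fun ω => ?_))
  have hR := quad_nonneg (hD.posDef_R k hk).posSemidef (control D p π μ k ω)
  rw [Real.norm_of_nonneg hR]
  have hmem : k ∈ Finset.range (D.N + 1) := Finset.mem_range.2 (by omega)
  have h1 := Finset.single_le_sum
    (f := fun k => quad (D.Q k) (state D p π μ k ω) + quad (D.R k) (control D p π μ k ω))
    (fun j hj => quadCost_summand_nonneg hD ω hj) hmem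
  have h2 := quad_nonneg (hD.posSemidef_Q (D.N + 1) le_rfl) (state D p π μ (D.N + 1) ω)
  have h3 := quad_nonneg (hD.posSemidef_Q k (by omega)) (state D p π μ k ω)
  simp only [quadCost] at h1 ⊢
  linarith

variable [IsProbabilityMeasure P]

lemma cost_eq_of_integrable (hD : D.WellPosed) (hp : p.HasLaws D P)
    (hπ : π ∈ admissibleTrigger n m Se) (hμ : μ ∈ admissibleControl n m Sc)
    (hi : Integrable (quadCost D p π μ) P) :
    cost D p π μ P = ((∫ ω, quadCost D p π μ ω ∂P
      + ∑ k ∈ Finset.range (D.N + 1), D.θ k * ∫ ω, transmit D p π μ k ω ∂P : ℝ) : EReal) := by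
  have hnn : 0 ≤ ∫ ω, quadCost D p π μ ω ∂P := integral_nonneg (quadCost_nonneg hD)
  have h1 := ofReal_integral_eq_lintegral_ofReal hi (ae_of_all _ (quadCost_nonneg hD))
  have h2 : ∫ ω, ∑ k ∈ Finset.range (D.N + 1),
      D.θ k * (if event D p π μ k ω then (1 : ℝ) else 0) ∂P
        = ∑ k ∈ Finset.range (D.N + 1), D.θ k * ∫ ω, transmit D p π μ k ω ∂P := by
    have hint : ∀ k, Integrable (fun ω => D.θ k * transmit D p π μ k ω) P := fun k =>
      (integrable_transmit hp hπ hμ k).const_mul _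
    simp only [← integral_const_mul]
    exact integral_finsetSum _ fun k _ => hint k
  unfold cost
  rw [h2]
  unfold quadCost at h1
  rw [← h1, EReal.coe_ennreal_ofReal]
  unfold quadCost at hnn
  rw [max_eq_left hnn, ← EReal.coe_add]
  rfl

/-- In the averaged square completion the cross terms vanish, as w_k is centred and independent of
(x_k, u_k). Square-integrable controls allow the terms to be integrated separately. -/
lemma integral_quadCost (hD : D.WellPosed) (hp : p.HasLaws D P)
    (hπ : π ∈ admissibleTrigger n m Se) (hμ : μ ∈ admissibleControl n m Sc)
    (hu : ∀ k ≤ D.N, MemLp (control D p π μ k) 2 P) :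
    ∫ ω, quadCost D p π μ ω ∂P = baseCost D P p + ∑ k ∈ Finset.range (D.N + 1),
      ∫ ω, quad (D.Lam k) (control D p π μ k ω + D.L k *ᵥ state D p π μ k ω) ∂P := by
  have hx : ∀ k ≤ D.N, MemLp (state D p π μ k) 2 P := fun k hk =>
    memLp_state hp fun j hj => hu j (by omega)
  have hq0 : Integrable (fun ω => quad (D.S 0) (p.x₀ ω)) P := integrable_quad _ hp.memLp_x₀
  have hqw : ∀ k, Integrable (fun ω => quad (D.S (k + 1)) (p.w k ω)) P := fun k =>
    integrable_quad _ (hp.memLp_w k)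
  have hqu : ∀ k ≤ D.N, Integrable (fun ω => quad (D.Lam k)
      (control D p π μ k ω + D.L k *ᵥ state D p π μ k ω)) P := fun k hk =>
    integrable_quad (f := fun ω => control D p π μ k ω + D.L k *ᵥ state D p π μ k ω) _
      ((hu k hk).add (memLp_mulVec _ (hx k hk)))
  have hY : ∀ k ≤ D.N, MemLp (fun ω => D.S (k + 1) *ᵥ
      (D.A k *ᵥ state D p π μ k ω + D.B k *ᵥ control D p π μ k ω)) 2 P := fun k hk =>
    memLp_mulVec _ ((memLp_mulVec _ (hx k hk)).add (memLp_mulVec _ (hu k hk)))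
  have hcr : ∀ k ≤ D.N, Integrable (fun ω => 2 * (p.w k ω ⬝ᵥ (D.S (k + 1) *ᵥ
      (D.A k *ᵥ state D p π μ k ω + D.B k *ᵥ control D p π μ k ω)))) P := fun k hk =>
    (integrable_dotProduct (hp.memLp_w k) (hY k hk)).const_mul 2
  have hcr0 : ∀ k ≤ D.N, ∫ ω, p.w k ω ⬝ᵥ (D.S (k + 1) *ᵥ
      (D.A k *ᵥ state D p π μ k ω + D.B k *ᵥ control D p π μ k ω)) ∂P = 0 := by
    intro k hk
    refine integral_dotProduct_eq_zero (hp.memLp_w k) (hY k hk) ?_ (hp.gaussian_w k).2.1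
    have hxm : Measurable fun q : Sc × Se × (Fin (k + 1) → Vec n) × (Fin k → Bool)
        × (Fin k → Vec m) => q.2.2.1 (Fin.last k) := measurable_pi_iff.1 measurable_snd.snd.fst _
    have hum : Measurable fun q : Sc × Se × (Fin (k + 1) → Vec n) × (Fin k → Bool)
        × (Fin k → Vec m) => μ k q.1 (signals q.2.2.1 q.2.2.2.1) q.2.2.2.2 :=
      (hμ k).comp (measurable_fst.prodMk ((measurable_signals measurable_snd.snd.fst
        measurable_snd.snd.snd.fst).prodMk measurable_snd.snd.snd.snd))
    exact (indepFun_hist_noise hp hπ hμ k).comp (measurable_mulVec (D.S (k + 1))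
      ((measurable_mulVec (D.A k) hxm).add (measurable_mulVec (D.B k) hum))) measurable_id
  have hpath : ∀ ω, quadCost D p π μ ω = _ := fun ω =>
    sum_quad_eq hD (x := fun k => state D p π μ k ω) (u := fun k => control D p π μ k ω)
      (w := fun k => p.w k ω) fun k => state_succ k ω
  simp only [hpath, state_zero]
  have hsum : ∀ k ∈ Finset.range (D.N + 1), Integrable (fun ω =>
      quad (D.Lam k) (control D p π μ k ω + D.L k *ᵥ state D p π μ k ω)
        + quad (D.S (k + 1)) (p.w k ω)
        + 2 * (p.w k ω ⬝ᵥ (D.S (k + 1) *ᵥ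
          (D.A k *ᵥ state D p π μ k ω + D.B k *ᵥ control D p π μ k ω)))) P := fun k hk => by
    have hk' := Finset.mem_range.1 hk
    exact ((hqu k (by omega)).add (hqw k)).add (hcr k (by omega))
  rw [integral_add hq0 (integrable_finsetSum _ hsum), integral_finsetSum _ hsum, baseCost,
    add_assoc, ← Finset.sum_add_distrib]
  congr 1
  refine Finset.sum_congr rfl fun k hk => ?_
  have hk' : k ≤ D.N := by have := Finset.mem_range.1 hk; omega
  have h12 : Integrable (fun ω =>
      quad (D.Lam k) (control D p π μ k ω + D.L k *ᵥ state D p π μ k ω)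
        + quad (D.S (k + 1)) (p.w k ω)) P := (hqu k hk').add (hqw k)
  rw [integral_add h12 (hcr k hk'), integral_add (hqu k hk') (hqw k), integral_const_mul,
    hcr0 k hk']
  ring

/-- The common lower bound on the cost in both deviations. -/
noncomputable def optimalCost (D : Data n m) (P : Measure Ω) (p : Primitives n Ω Se Sc) : ℝ :=
  baseCost D P p + ∫ ω, quad (D.Γ 0) (p.x₀ ω - D.m₀) ∂P + triggerValue D P p

/-- Stage k charges the error at time k + 1: the shift splits off the Γ_0 term, and Γ_{N+1} = 0
closes the sum. -/
lemma sum_stageCost (hp : p.HasLaws D P)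
    (hπ : π ∈ admissibleTrigger n m Se) (hμ : μ ∈ admissibleControl n m Sc) :
    ∑ k ∈ Finset.range (D.N + 1), ∫ ω, quad (D.Γ k) (err D p π μ k ω) ∂P
        + ∑ k ∈ Finset.range (D.N + 1), D.θ k * ∫ ω, transmit D p π μ k ω ∂P
      = ∫ ω, quad (D.Γ 0) (p.x₀ ω - D.m₀) ∂P
        + ∑ k ∈ Finset.range (D.N + 1), ∫ ω, stageCost D p π μ k ω ∂P := by
  have hstage : ∀ k, ∫ ω, stageCost D p π μ k ω ∂P = D.θ k * ∫ ω, transmit D p π μ k ω ∂P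
      + ∫ ω, quad (D.Γ (k + 1)) (err D p π μ (k + 1) ω) ∂P := by
    intro k
    unfold stageCost
    rw [integral_add ((integrable_transmit hp hπ hμ k).const_mul _)
      (integrable_quad _ (memLp_err hp hπ hμ (k + 1))), integral_const_mul]
  have hlast : ∫ ω, quad (D.Γ (D.N + 1)) (err D p π μ (D.N + 1) ω) ∂P = 0 := by
    simp [Data.Γ, quad_zero_left]
  have hshift := Finset.sum_range_succ'
    (fun k => ∫ ω, quad (D.Γ k) (err D p π μ k ω) ∂P) (D.N + 1)
  rw [Finset.sum_range_succ, hlast, add_zero] at hshift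
  simp only [hstage, Finset.sum_add_distrib]
  rw [hshift]
  simp only [err_zero]
  ring

/-- Under certainty equivalence the estimate follows a linear recursion driven by the
square-integrable error, whatever the trigger. -/
lemma memLp_control_controlStar (hp : p.HasLaws D P) (hπ : π ∈ admissibleTrigger n m Se)
    (k : ℕ) : MemLp (control D p π (controlStar D Sc) k) 2 P := by
  have hμ := controlStar_admissible (Sc := Sc) D
  have hxhat : ∀ j, MemLp (xhat D p π (controlStar D Sc) j) 2 P := by
    intro j
    induction j with
    | zero => exact memLp_const _
    | succ j ih =>
      simp only [funext (xhat_succ (D := D) (p := p) (π := π) (μ := controlStar D Sc) j),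
        control_controlStar]
      exact ((memLp_mulVec _ ih).add (memLp_mulVec _ (memLp_mulVec _ ih).neg)).add
        (memLp_ite hp hπ hμ j (memLp_mulVec _ (memLp_err hp hπ hμ j)) (memLp_const 0))
  exact (memLp_mulVec _ (hxhat k)).neg

/-- Here u_k + L_k x_k = L_k e_k, whose Λ_k-weight is the Γ_k-penalty of the error. -/
lemma cost_controlStar (hD : D.WellPosed) (hp : p.HasLaws D P)
    (hπ : π ∈ admissibleTrigger n m Se) :
    cost D p π (controlStar D Sc) P
      = ((baseCost D P p + ∫ ω, quad (D.Γ 0) (p.x₀ ω - D.m₀) ∂P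
        + ∑ k ∈ Finset.range (D.N + 1),
          ∫ ω, stageCost D p π (controlStar D Sc) k ω ∂P : ℝ) : EReal) := by
  have hμ := controlStar_admissible (Sc := Sc) D
  have hu : ∀ k ≤ D.N, MemLp (control D p π (controlStar D Sc) k) 2 P := fun k _ =>
    memLp_control_controlStar hp hπ k
  rw [cost_eq_of_integrable hD hp hπ hμ (integrable_quadCost hp hu),
    integral_quadCost hD hp hπ hμ hu]
  have hΓ : ∀ k ∈ Finset.range (D.N + 1),
      ∫ ω, quad (D.Lam k) (control D p π (controlStar D Sc) k ω
        + D.L k *ᵥ state D p π (controlStar D Sc) k ω) ∂P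
      = ∫ ω, quad (D.Γ k) (err D p π (controlStar D Sc) k ω) ∂P := by
    intro k hk
    have hk' : k ≤ D.N := by have := Finset.mem_range.1 hk; omega
    congr 1
    funext ω
    rw [quad_Gamma hD hk', control_controlStar, err, Matrix.mulVec_sub]
    congr 1
    abel
  rw [Finset.sum_congr rfl hΓ, add_assoc, sum_stageCost hp hπ hμ, add_assoc]

lemma cost_triggerStar_controlStar (hD : D.WellPosed) (hp : p.HasLaws D P) :
    cost D p (triggerStar D P p.w Se) (controlStar D Sc) P = (optimalCost D P p : EReal) := by
  rw [cost_controlStar hD hp (triggerStar_admissible hp), optimalCost,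
    triggerValue_eq hD hp (controlStar_admissible D)]

lemma optimalCost_le_cost_controlStar (hD : D.WellPosed) (hp : p.HasLaws D P)
    (hπ : π ∈ admissibleTrigger n m Se) :
    (optimalCost D P p : EReal) ≤ cost D p π (controlStar D Sc) P := by
  rw [cost_controlStar hD hp hπ, optimalCost, EReal.coe_le_coe_iff]
  have := triggerValue_le hD hp hπ (controlStar_admissible (Sc := Sc) D)
  linarith

/-- In u_k + L_k x_k = L_k e_k + (u_k + L_k x̂_k) the second summand is a function of the
controller's information, so symmetry removes the cross term; the remaining square is nonnegative.
-/
lemma integral_quad_Gamma_err_le (hD : D.WellPosed) (hp : p.HasLaws D P)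
    (hμ : μ ∈ admissibleControl n m Sc) {k : ℕ} (hk : k ≤ D.N)
    (hu : ∀ j ≤ k, MemLp (control D p (triggerStar D P p.w Se) μ j) 2 P) :
    ∫ ω, quad (D.Γ k) (err D p (triggerStar D P p.w Se) μ k ω) ∂P ≤
      ∫ ω, quad (D.Lam k) (control D p (triggerStar D P p.w Se) μ k ω
        + D.L k *ᵥ state D p (triggerStar D P p.w Se) μ k ω) ∂P := by
  set π := triggerStar D P p.w Se with hπ_def
  have hπ : π ∈ admissibleTrigger n m Se := triggerStar_admissible hp
  have hLam := (Lam_posDef hD hk).posSemidef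
  have he := memLp_err hp hπ hμ k
  have hx : MemLp (state D p π μ k) 2 P := memLp_state hp fun j hj => hu j hj.le
  have hxh : MemLp (xhat D p π μ k) 2 P := by
    rw [xhat_eq_sub]
    exact hx.sub he
  have hv : MemLp (fun ω => control D p π μ k ω + D.L k *ᵥ xhat D p π μ k ω) 2 P :=
    (hu k le_rfl).add (memLp_mulVec _ hxh)
  have hcross : ∫ ω, (control D p π μ k ω + D.L k *ᵥ xhat D p π μ k ω)
      ⬝ᵥ ((D.Lam k * D.L k) *ᵥ err D p π μ k ω) ∂P = 0 :=
    integral_dotProduct_err_eq_zero hp hμ k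
      (g := fun I : Info n m Sc k => μ k I.1 I.2.1 I.2.2 + D.L k *ᵥ D.estimate k I.2.1 I.2.2)
      ((hμ k).add (measurable_mulVec _ (measurable_estimate D measurable_snd.fst
        measurable_snd.snd))) _
  have hic : Integrable (fun ω => 2 * ((control D p π μ k ω + D.L k *ᵥ xhat D p π μ k ω)
      ⬝ᵥ ((D.Lam k * D.L k) *ᵥ err D p π μ k ω))) P :=
    (integrable_dotProduct hv (memLp_mulVec _ he)).const_mul 2
  have hid : ∀ ω, quad (D.Lam k) (control D p π μ k ω + D.L k *ᵥ state D p π μ k ω)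
      = quad (D.Γ k) (err D p π μ k ω)
        + 2 * ((control D p π μ k ω + D.L k *ᵥ xhat D p π μ k ω)
          ⬝ᵥ ((D.Lam k * D.L k) *ᵥ err D p π μ k ω))
        + quad (D.Lam k) (control D p π μ k ω + D.L k *ᵥ xhat D p π μ k ω) := by
    intro ω
    have hx : control D p π μ k ω + D.L k *ᵥ state D p π μ k ω = D.L k *ᵥ err D p π μ k ω
        + (control D p π μ k ω + D.L k *ᵥ xhat D p π μ k ω) := by
      rw [err, Matrix.mulVec_sub]; abel
    rw [hx, quad_add (transpose_eq_of_posSemidef hLam), quad_Gamma hD hk, Matrix.mulVec_mulVec]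
  have hΓ := integrable_quad (D.Γ k) he
  have h12 : Integrable (fun ω => quad (D.Γ k) (err D p π μ k ω)
        + 2 * ((control D p π μ k ω + D.L k *ᵥ xhat D p π μ k ω)
          ⬝ᵥ ((D.Lam k * D.L k) *ᵥ err D p π μ k ω))) P := hΓ.add hic
  simp only [hid]
  rw [integral_add h12 (integrable_quad _ hv), integral_add hΓ hic, integral_const_mul, hcross]
  have := integral_nonneg (μ := P) (f := fun ω => quad (D.Lam k)
    (control D p π μ k ω + D.L k *ᵥ xhat D p π μ k ω)) fun ω => quad_nonneg hLam _
  linarith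

lemma optimalCost_le_cost_triggerStar (hD : D.WellPosed) (hp : p.HasLaws D P)
    (hμ : μ ∈ admissibleControl n m Sc) :
    (optimalCost D P p : EReal) ≤ cost D p (triggerStar D P p.w Se) μ P := by
  have hπ : triggerStar D P p.w Se ∈ admissibleTrigger n m Se := triggerStar_admissible hp
  by_cases htop : cost D p (triggerStar D P p.w Se) μ P = ⊤
  · rw [htop]; exact le_top
  have hu : ∀ k ≤ D.N, MemLp (control D p (triggerStar D P p.w Se) μ k) 2 P := fun k hk =>
    memLp_control_of_cost_ne_top hD hp hπ hμ htop hk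
  rw [cost_eq_of_integrable hD hp hπ hμ (integrable_quadCost hp hu),
    integral_quadCost hD hp hπ hμ hu, optimalCost, triggerValue_eq hD hp hμ, EReal.coe_le_coe_iff]
  have h1 := sum_stageCost hp hπ hμ
  have h2 := Finset.sum_le_sum fun k (hk : k ∈ Finset.range (D.N + 1)) =>
    have hk' : k ≤ D.N := Nat.lt_succ_iff.1 (Finset.mem_range.1 hk)
    integral_quad_Gamma_err_le hD hp hμ hk' fun j hj => hu j (hj.trans hk')
  linarith

end Cost

/-! ### Information used by the policies -/

section Information

variable {Ω Se Sc : Type*} {D : Data n m} {p : Primitives n Ω Se Sc}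
  {π : TriggerPolicy n m Se} {μ : ControlPolicy n m Sc}

lemma states_init (k : ℕ) (ω : Ω) :
    states D p π μ k ω = Fin.init (states D p π μ (k + 1) ω) := by
  rw [states, states, hist_succ]
  exact (Fin.init_snoc (α := fun _ => Vec n) _ _).symm

lemma received_init (k : ℕ) (ω : Ω) :
    received D p π μ k ω = Fin.init (received D p π μ (k + 1) ω) := by
  rw [received_succ]
  exact (Fin.init_snoc (α := fun _ => Signal n) _ _).symm

lemma comap_le_comap_of_eq_init {β : Type*} [MeasurableSpace β] {j : ℕ} {f : Ω → Fin j → β}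
    {g : Ω → Fin (j + 1) → β} (h : ∀ ω, f ω = Fin.init (g ω)) :
    MeasurableSpace.comap f inferInstance ≤ MeasurableSpace.comap g inferInstance := by
  rw [show f = Fin.init ∘ g from funext h, ← MeasurableSpace.comap_comp]
  exact MeasurableSpace.comap_mono measurable_init.comap_le

/-- If neither policy uses its seed, then the history and the events are measurable functions of
the states. -/
lemma measurable_hist_event_comap_states [MeasurableSpace Se] [MeasurableSpace Sc]
    (hπ : π ∈ admissibleTrigger n m Se) (hμ : μ ∈ admissibleControl n m Sc)
    (hπs : ∀ k s s' x δ u, π k s x δ u = π k s' x δ u) (hμs : NonRandomized μ) (ω₀ : Ω) (k : ℕ) :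
    Measurable[MeasurableSpace.comap (states D p π μ k) inferInstance] (hist D p π μ k) ∧
      Measurable[MeasurableSpace.comap (states D p π μ k) inferInstance] (event D p π μ k) := by
  -- As the seeds are ignored, they can be frozen at ω₀, which leaves functions of the history
  -- alone.
  have hcontrol : ∀ k, control D p π μ k =
      (fun q : (Fin k → Signal n) × (Fin k → Vec m) => μ k (p.η ω₀) q.1 q.2) ∘
        fun ω => (received D p π μ k ω, controls D p π μ k ω) := fun k => funext fun ω =>
    hμs k _ _ _ _
  have hevent : ∀ k, event D p π μ k =
      (fun q : (Fin (k + 1) → Vec n) × (Fin k → Bool) × (Fin k → Vec m) =>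
        π k (p.ξ ω₀) q.1 q.2.1 q.2.2) ∘ hist D p π μ k := fun k => funext fun ω =>
    hπs k _ _ _ _ _
  have hπ' : ∀ k, Measurable fun q : (Fin (k + 1) → Vec n) × (Fin k → Bool) × (Fin k → Vec m) =>
      π k (p.ξ ω₀) q.1 q.2.1 q.2.2 := fun k =>
    (hπ k).comp (measurable_const.prodMk measurable_id)
  have hμ' : ∀ k, Measurable fun q : (Fin k → Signal n) × (Fin k → Vec m) =>
      μ k (p.η ω₀) q.1 q.2 := fun k => (hμ k).comp (measurable_const.prodMk measurable_id)
  have key : Measurable[MeasurableSpace.comap (states D p π μ k) inferInstance]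
      (hist D p π μ k) := by
    induction k with
    | zero =>
      have h2 : Measurable[MeasurableSpace.comap (states D p π μ 0) inferInstance]
          fun ω => (hist D p π μ 0 ω).2 := measurable_const
      exact (comap_measurable (states D p π μ 0)).prodMk h2
    | succ k ih =>
      have hle := comap_le_comap_of_eq_init (states_init (D := D) (p := p) (π := π) (μ := μ) k)
      have ih' := ih.mono hle le_rfl
      have hδ := (hπ' k).comp ih'
      rw [← hevent k] at hδ
      have hz : Measurable[MeasurableSpace.comap (states D p π μ (k + 1)) inferInstance]
          (received D p π μ k) := measurable_signals ih'.fst ih'.snd.fst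
      have hu := (hμ' k).comp (hz.prodMk ih'.snd.snd)
      have hu' : Measurable[MeasurableSpace.comap (states D p π μ (k + 1)) inferInstance]
          (control D p π μ k) := by
        rw [hcontrol k]
        exact hu
      have h2 : Measurable[MeasurableSpace.comap (states D p π μ (k + 1)) inferInstance]
          fun ω => (hist D p π μ (k + 1) ω).2 := by
        simp only [hist_succ]
        exact (measurable_snoc ih'.snd.fst hδ).prodMk (measurable_snoc ih'.snd.snd hu')
      exact (comap_measurable (states D p π μ (k + 1))).prodMk h2
  refine ⟨key, ?_⟩
  rw [hevent k]
  exact (hπ' k).comp key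

/-- Past controls are themselves computed from past signals, so conditioning on the signals alone
suffices. -/
lemma measurable_xhat_comap_received (D : Data n m) (p : Primitives n Ω Se Sc)
    (π : TriggerPolicy n m Se) (k : ℕ) :
    Measurable[MeasurableSpace.comap (received D p π (controlStar D Sc) k) inferInstance]
      (xhat D p π (controlStar D Sc) k) := by
  have hu : Measurable[MeasurableSpace.comap (received D p π (controlStar D Sc) k) inferInstance]
      (controls D p π (controlStar D Sc) k) := by
    induction k with
    | zero => exact measurable_const
    | succ k ih =>
      have hle := comap_le_comap_of_eq_init
        (received_init (D := D) (p := p) (π := π) (μ := controlStar D Sc) k)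
      have hx := measurable_estimate D (comap_measurable (received D p π (controlStar D Sc) k)) ih
      exact measurable_snoc (ih.mono hle le_rfl)
        ((measurable_mulVec (D.L k) hx).neg.mono hle le_rfl)
  exact measurable_estimate D (comap_measurable _) hu

lemma nonRandomized_controlStar (D : Data n m) (Sc : Type*) :
    NonRandomized (controlStar D Sc) := fun _ _ _ _ _ => rfl

/-- At the equilibrium the estimate is the conditional mean of the state. -/
lemma xhat_ae_eq_condExp [MeasurableSpace Ω] [MeasurableSpace Se] [MeasurableSpace Sc]
    {P : Measure Ω} [IsProbabilityMeasure P] (hp : p.HasLaws D P) (k : ℕ) :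
    xhat D p (triggerStar D P p.w Se) (controlStar D Sc) k =ᵐ[P]
      P[state D p (triggerStar D P p.w Se) (controlStar D Sc) k |
        MeasurableSpace.comap
          (received D p (triggerStar D P p.w Se) (controlStar D Sc) k) inferInstance] := by
  set π := triggerStar D P p.w Se with hπ_def
  have hπ : π ∈ admissibleTrigger n m Se := triggerStar_admissible hp
  have hμ := controlStar_admissible (Sc := Sc) D
  have hz := measurable_received hp hπ hμ k
  have hx : Integrable (state D p π (controlStar D Sc) k) P :=
    (memLp_state hp fun j _ => memLp_control_controlStar hp hπ j).integrable one_le_two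
  have he : Integrable (err D p π (controlStar D Sc) k) P :=
    (memLp_err hp hπ hμ k).integrable one_le_two
  have hxh : Integrable (xhat D p π (controlStar D Sc) k) P := by
    rw [xhat_eq_sub]
    exact hx.sub he
  refine ae_eq_condExp_of_forall_setIntegral_eq hz.comap_le hx (fun s _ _ => hxh.integrableOn)
    ?_ (measurable_xhat_comap_received D p π k).stronglyMeasurable.aestronglyMeasurable
  rintro s ⟨t, ht, rfl⟩ -
  -- The error restricted to an event of the received signals is odd in the error, so its integral
  -- is zero: the defining property of the conditional mean.
  have hodd := integral_eq_zero_of_odd hp hμ k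
    (φ := fun q : Info n m Sc k × Vec n => {q : Info n m Sc k × Vec n | q.1.2.1 ∈ t}.indicator
      (fun q => q.2) q)
    ((measurable_snd.indicator (measurable_fst.snd.fst ht)).stronglyMeasurable)
    (fun I e => by by_cases h : I.2.1 ∈ t <;> simp [Set.indicator, h])
  have hset : ∫ ω in received D p π (controlStar D Sc) k ⁻¹' t,
      err D p π (controlStar D Sc) k ω ∂P = 0 := by
    rw [← integral_indicator (hz ht)]
    exact hodd
  unfold err at hset
  rw [integral_sub hx.integrableOn hxh.integrableOn, sub_eq_zero] at hset
  exact hset.symm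

end Information

end EventTrig
-- The equilibrium theorem
theorem theorem2 {n m : ℕ} (D : EventTrig.Data n m) (hD : D.WellPosed)
    {Ω Se Sc : Type*} [MeasurableSpace Ω] [MeasurableSpace Se] [MeasurableSpace Sc]
    (P : Measure Ω) [IsProbabilityMeasure P]
    (p : EventTrig.Primitives n Ω Se Sc) (hp : p.HasLaws D P) :
    -- the pair of policies is a Nash equilibrium for the cost, with finite equilibrium cost
    EventTrig.IsNashEquilibrium
      (EventTrig.admissibleTrigger n m Se) (EventTrig.admissibleControl n m Sc)
      (fun π μ => EventTrig.cost D p π μ P)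
      (EventTrig.triggerStar D P p.w Se) (EventTrig.controlStar D Sc) ∧
    EventTrig.cost D p (EventTrig.triggerStar D P p.w Se) (EventTrig.controlStar D Sc) P ≠ ⊤ ∧
    -- the threshold rule is symmetric in the estimation error
    (∀ k ≤ D.N, ∀ e : EventTrig.Vec n,
      EventTrig.rho D P p.w k (-e) = EventTrig.rho D P p.w k e ∧
      EventTrig.voi D P p.w k (-e) = EventTrig.voi D P p.w k e) ∧
    -- against every non-randomized control policy, in particular at the equilibrium, the events
    -- of the threshold rule are measurable functions of the observed states `x_0, …, x_k`
    EventTrig.NonRandomized (EventTrig.controlStar D Sc) ∧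
    (∀ μ ∈ EventTrig.admissibleControl n m Sc, EventTrig.NonRandomized μ → ∀ k ≤ D.N,
      Measurable[MeasurableSpace.comap
          (EventTrig.states D p (EventTrig.triggerStar D P p.w Se) μ k) inferInstance]
        (EventTrig.event D p (EventTrig.triggerStar D P p.w Se) μ k)) ∧
    -- at the equilibrium the estimate is the conditional mean of the state at the controller
    (∀ k ≤ D.N,
      EventTrig.xhat D p (EventTrig.triggerStar D P p.w Se) (EventTrig.controlStar D Sc) k
        =ᵐ[P]
      P[EventTrig.state D p (EventTrig.triggerStar D P p.w Se) (EventTrig.controlStar D Sc) k |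
        MeasurableSpace.comap
          (EventTrig.received D p (EventTrig.triggerStar D P p.w Se)
            (EventTrig.controlStar D Sc) k) inferInstance]) := by
  have hπ := EventTrig.triggerStar_admissible (Se := Se) hp
  have hμ := EventTrig.controlStar_admissible (Sc := Sc) D
  refine ⟨⟨hπ, hμ, fun π' hπ' => ?_, fun μ' hμ' => ?_⟩, ?_, fun k _ e =>
    ⟨EventTrig.rho_neg hp k e, EventTrig.voi_neg hp k e⟩,
    EventTrig.nonRandomized_controlStar D Sc, fun μ hμ hnr k _ => ?_,
    fun k _ => EventTrig.xhat_ae_eq_condExp hp k⟩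
  · exact (EventTrig.cost_triggerStar_controlStar hD hp).trans_le
      (EventTrig.optimalCost_le_cost_controlStar hD hp hπ')
  · exact (EventTrig.cost_triggerStar_controlStar hD hp).trans_le
      (EventTrig.optimalCost_le_cost_triggerStar hD hp hμ')
  · rw [EventTrig.cost_triggerStar_controlStar hD hp]
    exact EReal.coe_ne_top _
  · exact (EventTrig.measurable_hist_event_comap_states hπ hμ (fun _ _ _ _ _ _ => rfl) hnr
      (nonempty_of_isProbabilityMeasure P).some k).2
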